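/- Let $a,b,c$ be integers and let $p$ be a prime with $p\nmid abc$ and $p\equiv 1 \pmod 9$. Assume that none of the residues $\overline{a/b},\overline{b/c},\overline{c/a}\in\mathbb F_p^*$ is a $9$th power in $\mathbb F_p^*$. Let $$S_{9,p}=\{(\alpha,\beta)\in\mathbb F_p^*\times\mathbb F_p^* : \overline a\alpha^9+\overline b\beta^9+\overline c\gamma^9=0\ \text{for some}\ \gamma\in\mathbb F_p^*\},$$ and for $P=(\alpha,\beta)\in S_{9,p}$ let $\mathcal E_{9,p,P}$ be the elliptic curve $Y^2=X(X-\overline a\alpha^9)(X+\overline b\beta^9)$ over $\mathbb F_p$. Assume that $3$ divides the trace of Frobenius $a_p(\mathcal E_{9,p,P})=p+1-\#\mathcal E_{9,p,P}(\mathbb F_p)$ for every $P\in S_{9,p}$. Let $x,y,z$ be integers with $ax^9+by^9+cz^9=0$, $xyz\neq 0$ and $\gcd(x,y,z)=1$, and let $E_9$ be the Frey curve $Y^2=X(X-ax^9)(X+by^9)$ over $\mathbb Q$. Then the representation $\rho_3^{E_9}$ of $G_{\mathbb Q}=\mathrm{Gal}(\overline{\mathbb Q}/\mathbb Q)$ on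 $E_9[3]$ is strongly irreducible, i.e. its restriction to $G_{\mathbb Q(\sqrt{-3})}$ is absolutely irreducible (irreducible after extending scalars from $\mathbb F_3$ to $\overline{\mathbb F}_3$). -/

import Mathlib

open scoped TensorProduct

/-- The absolute Galois group `G_ℚ = Gal(ℚ̄/ℚ)`. -/
abbrev GQ : Type := AlgebraicClosure ℚ ≃ₐ[ℚ] AlgebraicClosure ℚ

/-- The subgroup `G_{ℚ(√d)}` of `G_ℚ`: the automorphisms of `ℚ̄` fixing the field generated over `ℚ`
by the square roots of `d`. -/
noncomputable def GQSqrt (d : ℤ) : Subgroup GQ :=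
  (IntermediateField.adjoin ℚ {t : AlgebraicClosure ℚ | t ^ 2 = (d : AlgebraicClosure ℚ)}).fixingSubgroup

/-- Extension of scalars of a representation along a field extension `K / k`. -/
noncomputable def repBaseChange {k G V : Type*} (K : Type*) [Field k] [Monoid G] [AddCommGroup V]
    [Module k V] [Field K] [Algebra k K] (ρ : Representation k G V) :
    Representation K G (K ⊗[k] V) :=
  (Module.End.baseChangeHom k K V : Module.End k V →* Module.End K (K ⊗[k] V)).comp ρ

/-- A representation is absolutely irreducible if it is irreducible over an algebraic closure of
its field of coefficients. -/
def IsAbsolutelyIrreducible {k G V : Type*} [Field k] [Monoid G] [AddCommGroup V] [Module k V]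
    (ρ : Representation k G V) : Prop :=
  (repBaseChange (AlgebraicClosure k) ρ).IsIrreducible

/-- For an odd prime `l`, a (two-dimensional) mod `l` representation `ρ` of `G_ℚ` is strongly
irreducible if its restriction to `G_{ℚ(√l*)}` is absolutely irreducible, where
`l* = (-1)^((l-1)/2) l`. -/
def IsStronglyIrreducible (l : ℕ) [Fact l.Prime] {V : Type*} [AddCommGroup V] [Module (ZMod l) V]
    (ρ : Representation (ZMod l) GQ V) : Prop :=
  IsAbsolutelyIrreducible (ρ.comp (GQSqrt ((-1) ^ ((l - 1) / 2) * (l : ℤ))).subtype)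

open Classical in
/-- The group `E(ℚ̄)` of geometric points of a Weierstrass curve `E` over `ℚ`. -/
noncomputable instance geomPointsAddCommGroup (E : WeierstrassCurve ℚ) :
    AddCommGroup (E.baseChange (AlgebraicClosure ℚ)).toAffine.Point :=
  inferInstance

/-- The `l`-torsion subgroup `E[l]` of `E(ℚ̄)`. -/
abbrev geomTorsion (E : WeierstrassCurve ℚ) (l : ℕ) : Type :=
  AddSubgroup.torsionBy (E.baseChange (AlgebraicClosure ℚ)).toAffine.Point (l : ℤ)

noncomputable instance geomTorsionModule (E : WeierstrassCurve ℚ) (l : ℕ) :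
    Module (ZMod l) (geomTorsion E l) :=
  AddSubgroup.torsionBy.zmodModule

open Classical in
/-- The action of `σ ∈ G_ℚ` on `E(ℚ̄)` through the coordinates of points. -/
noncomputable def galoisOnPoints (E : WeierstrassCurve ℚ) (σ : GQ) :
    (E.baseChange (AlgebraicClosure ℚ)).toAffine.Point →+
      (E.baseChange (AlgebraicClosure ℚ)).toAffine.Point :=
  WeierstrassCurve.Affine.Point.map (W' := E.toAffine) (σ : AlgebraicClosure ℚ →ₐ[ℚ] AlgebraicClosure ℚ)

/-- The mod `l` Galois representation `ρ_l^E`: the natural action of `G_ℚ` on `E[l]`. -/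
noncomputable def modRep (E : WeierstrassCurve ℚ) (l : ℕ) :
    Representation (ZMod l) GQ (geomTorsion E l) where
  toFun σ := AddMonoidHom.toZModLinearMap l
    (((galoisOnPoints E σ).comp (AddSubgroup.subtype _)).codRestrict _ fun P => by
      rw [AddSubgroup.torsionBy.nsmul_iff, AddMonoidHom.comp_apply, ← map_nsmul, ← map_nsmul,
        AddSubgroup.torsionBy.nsmul, map_zero, map_zero])
  map_one' := by
    ext P
    rcases P with ⟨_ | _, hP⟩ <;> rfl
  map_mul' σ τ := by
    ext P
    rcases P with ⟨_ | _, hP⟩ <;> rfl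

/-- The curve `Y² = X (X - A) (X + B)`, in expanded form `Y² = X³ + (B - A) X² - A B X`. -/
def freyCurve {R : Type*} [CommRing R] (A B : R) : WeierstrassCurve R where
  a₁ := 0
  a₂ := B - A
  a₃ := 0
  a₄ := -(A * B)
  a₆ := 0

/-- The trace of Frobenius `a_p(E) = p + 1 - #E(𝔽_p)` of a curve over `𝔽_p`. -/
noncomputable def traceFrob {p : ℕ} [Fact p.Prime] (E : WeierstrassCurve (ZMod p)) : ℤ :=
  p + 1 - Nat.card E.toAffine.Point

/-- The set `S_{n,p}` of pairs `(α, β)` of nonzero residues for which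
`a α^n + b β^n + c γ^n = 0` for some nonzero residue `γ`. -/
def fermatPairs (a b c : ℤ) (n p : ℕ) : Set ((ZMod p)ˣ × (ZMod p)ˣ) :=
  {P | ∃ γ : (ZMod p)ˣ, (a : ZMod p) * (P.1 : ZMod p) ^ n + (b : ZMod p) * (P.2 : ZMod p) ^ n
    + (c : ZMod p) * (γ : ZMod p) ^ n = 0}

/-- The element `t` of `𝔽_p` is the `n`-th power of a nonzero residue. -/
def IsUnitPow {p : ℕ} (n : ℕ) (t : ZMod p) : Prop :=
  ∃ u : (ZMod p)ˣ, t = (u : ZMod p) ^ n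

/-! Put A = ax⁹, B = by⁹, C = cz⁹, so A + B + C = 0 and the Frey curve has discriminant 16(ABC)².
Over `ZMod 3`, a representation on a space of at most 9 elements is absolutely irreducible once its
image has an element of order divisible by 3 and it stabilises no line: a power of that element is a
transvection, whose only stable line, even over the algebraic closure, is the rational one
(`isAbsolutelyIrreducible_of_card_le`). Both conditions are checked on G_{ℚ(√-3)}.

Order divisible by 3: the four roots of the 3-division polynomial give a number c with c³ = (4ABC)²
(`resolvent_cube_eq`). If G_{ℚ(√-3)} fixed c, then (4ABC)² would be a cube in ℚ(√-3), hence in ℚ,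
and so 4ABC would be a rational cube. With A + B + C = 0 this reduces to Euler's equation α³ + β³ =
2γ³, solved by descent in ℤ[ω], and forces two of A, B, C to be equal (`eq_of_four_mul_cube`). Then
one of a/b, b/c, c/a is a 9th power mod p, which is excluded. Otherwise some g moves c, and it
multiplies c by a primitive cube root of unity.

No stable line: a stable line gives a root of the 3-division polynomial in ℚ(√-3), the abscissa of
its generators. As p ≡ 1 mod 3, this field embeds in ℚ_p and the root reduces to 𝔽_p. The reduced
curve or its quadratic twist then has a point of order 3, so a_p ≡ ±(p + 1) ≡ ±2 mod 3, against 3 ∣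
a_p (`threeDivision_ne_zero_of_three_dvd_trace`). -/

/-! ### The 3-division polynomial and points of order 3 -/

/-- The value at `x` of the `3`-division polynomial of `Y² = X³ + a₂ X² + a₄ X`. -/
def threeDivision {F : Type*} [CommRing F] (a₂ a₄ x : F) : F :=
  3 * x ^ 4 + 4 * a₂ * x ^ 3 + 6 * a₄ * x ^ 2 - a₄ ^ 2

theorem map_threeDivision {F K : Type*} [CommRing F] [CommRing K] (f : F →+* K) (a₂ a₄ x : F) :
    f (threeDivision a₂ a₄ x) = threeDivision (f a₂) (f a₄) (f x) := by
  simp only [threeDivision, map_sub, map_add, map_mul, map_pow, map_ofNat]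

theorem equation_iff_of_two_torsion_origin {F : Type*} [CommRing F] (W : WeierstrassCurve F)
    (h1 : W.a₁ = 0) (h3 : W.a₃ = 0) (h6 : W.a₆ = 0) (x y : F) :
    W.toAffine.Equation x y ↔ y ^ 2 = x ^ 3 + W.a₂ * x ^ 2 + W.a₄ * x := by
  rw [WeierstrassCurve.Affine.equation_iff]
  simp [h1, h3, h6]

theorem nonsingular_iff_of_two_torsion_origin {F : Type*} [Field F] (h2 : (2 : F) ≠ 0)
    (W : WeierstrassCurve F)
    (h1 : W.a₁ = 0) (h3 : W.a₃ = 0) (h6 : W.a₆ = 0) (x y : F) :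
    W.toAffine.Nonsingular x y ↔ y ^ 2 = x ^ 3 + W.a₂ * x ^ 2 + W.a₄ * x ∧
      (y ≠ 0 ∨ 3 * x ^ 2 + 2 * W.a₂ * x + W.a₄ ≠ 0) := by
  rw [WeierstrassCurve.Affine.nonsingular_iff, equation_iff_of_two_torsion_origin W h1 h3 h6]
  simp only [h1, h3]
  refine and_congr_right fun _ => ?_
  rw [or_comm]
  refine or_congr ?_ ?_
  · rw [not_iff_not]
    constructor
    · intro h
      have : 2 * y = 0 := by linear_combination h
      simpa [h2] using this
    · rintro rfl; simp
  · rw [not_iff_not]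
    constructor <;> intro h <;> linear_combination -h

/-- The condition reads 2P = -P. For y ≠ 0, the duplication formula makes x(2P) - x equal to the
division polynomial up to the factor -4y². For y = 0 both sides fail: 3P = P ≠ 0, and the polynomial
is minus the square of the derivative of the cubic, nonzero by nonsingularity. -/
theorem three_nsmul_some_eq_zero_iff {F : Type*} [Field F] [DecidableEq F] (h2 : (2 : F) ≠ 0)
    (W : WeierstrassCurve F) (h1 : W.a₁ = 0) (h3 : W.a₃ = 0) (h6 : W.a₆ = 0) (x y : F)
    (h : W.toAffine.Nonsingular x y) :
    3 • (WeierstrassCurve.Affine.Point.some x y h) = 0 ↔ threeDivision W.a₂ W.a₄ x = 0 := by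
  have hns := (nonsingular_iff_of_two_torsion_origin h2 W h1 h3 h6 x y).1 h
  have hneg : W.toAffine.negY x y = -y := by simp [WeierstrassCurve.Affine.negY, h1, h3]
  have key : threeDivision W.a₂ W.a₄ x =
      4 * y ^ 2 * (3 * x + W.a₂) - (3 * x ^ 2 + 2 * W.a₂ * x + W.a₄) ^ 2 := by
    rw [hns.1, threeDivision]; ring
  rw [show (3 : ℕ) = 2 + 1 from rfl, succ_nsmul, two_nsmul]
  by_cases hy : y = 0
  · rw [WeierstrassCurve.Affine.Point.add_self_of_Y_eq (by rw [hneg, hy, neg_zero]), zero_add]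
    refine iff_of_false (WeierstrassCurve.Affine.Point.some_ne_zero h) ?_
    rw [key, hy]
    have := hns.2.resolve_left (not_not.2 hy)
    simpa using this
  · have hyn : y ≠ W.toAffine.negY x y := by
      rw [hneg]
      intro h'
      have : 2 * y = 0 := by linear_combination h'
      simp [h2, hy] at this
    rw [WeierstrassCurve.Affine.Point.add_self_of_Y_ne' hyn, neg_add_eq_zero,
      WeierstrassCurve.Affine.Point.some.injEq]
    have hs : W.toAffine.slope x x y y * (2 * y) = 3 * x ^ 2 + 2 * W.a₂ * x + W.a₄ := by
      rw [WeierstrassCurve.Affine.slope_of_Y_ne rfl hyn, hneg, h1]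
      have : y - -y ≠ 0 := by
        intro h'
        exact hyn (by rw [hneg]; linear_combination h')
      rw [div_mul_eq_mul_div, div_eq_iff this]
      ring
    set l := W.toAffine.slope x x y y with hl
    have hX : W.toAffine.addX x x l = l ^ 2 - W.a₂ - 2 * x := by
      simp only [WeierstrassCurve.Affine.addX, h1]; ring
    have hY : W.toAffine.negAddY x x y l = l * (W.toAffine.addX x x l - x) + y := rfl
    have hd : threeDivision W.a₂ W.a₄ x = -(4 * y ^ 2) * (W.toAffine.addX x x l - x) := by
      rw [key, hX, ← hs]; ring
    constructor
    · rintro ⟨hx, -⟩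
      rw [hd, hx]; ring
    -- Equality of abscissas suffices: -2P is the third point on the tangent at P, so its ordinate
    -- is then y.
    · intro h0
      rw [hd] at h0
      have : W.toAffine.addX x x l - x = 0 := by
        have h4 : -(4 * y ^ 2) ≠ 0 := by
          rw [neg_ne_zero, show (4 : F) = 2 * 2 by norm_num]
          exact mul_ne_zero (mul_ne_zero h2 h2) (pow_ne_zero _ hy)
        exact (mul_eq_zero.1 h0).resolve_left h4
      exact ⟨sub_eq_zero.1 this, by rw [hY, this]; ring⟩

/-- The discriminant condition `a₄² (a₂² - 4 a₄) ≠ 0` makes every point nonsingular. -/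
theorem nonsingular_of_disc_ne_zero {F : Type*} [Field F] (h2 : (2 : F) ≠ 0)
    (W : WeierstrassCurve F) (h1 : W.a₁ = 0) (h3 : W.a₃ = 0) (h6 : W.a₆ = 0)
    (h4 : W.a₄ ≠ 0) (hd : W.a₂ ^ 2 - 4 * W.a₄ ≠ 0) (x y : F)
    (h : y ^ 2 = x ^ 3 + W.a₂ * x ^ 2 + W.a₄ * x) : W.toAffine.Nonsingular x y := by
  rw [nonsingular_iff_of_two_torsion_origin h2 W h1 h3 h6]
  refine ⟨h, ?_⟩
  by_contra! hc
  obtain ⟨rfl, h'⟩ := hc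
  have h0 : x * (x ^ 2 + W.a₂ * x + W.a₄) = 0 := by linear_combination -h
  rcases mul_eq_zero.1 h0 with rfl | hx
  · apply h4; linear_combination h'
  · have : x * (2 * x + W.a₂) = 0 := by linear_combination h' - hx
    rcases mul_eq_zero.1 this with rfl | hx'
    · apply h4; linear_combination h'
    · apply hd
      linear_combination (2 * x + W.a₂) * hx' - 4 * hx

/-! ### Point counts over finite fields and quadratic twists -/

/-- The number of affine points of `y² = g(x)` over a finite field, as a character sum. -/
theorem card_sq_eq_eq_sum_quadraticChar {F : Type*} [Field F] [Fintype F] [DecidableEq F]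
    (hF : ringChar F ≠ 2) (g : F → F) :
    (Nat.card {P : F × F // P.2 ^ 2 = g P.1} : ℤ) = ∑ x, (quadraticChar F (g x) + 1) := by
  have e : {P : F × F // P.2 ^ 2 = g P.1} ≃ (x : F) × {y : F // y ^ 2 = g x} :=
    { toFun := fun P => ⟨P.1.1, P.1.2, P.2⟩
      invFun := fun P => ⟨(P.1, P.2.1), P.2.2⟩
      left_inv := fun _ => rfl
      right_inv := fun _ => rfl }
  rw [Nat.card_congr e, Nat.card_sigma, Nat.cast_sum]
  refine Finset.sum_congr rfl fun x _ => ?_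
  rw [← quadraticChar_card_sqrts hF, Nat.card_eq_fintype_card, Set.toFinset_card]
  rfl

theorem card_point_eq_sum_quadraticChar {F : Type*} [Field F] [Fintype F] [DecidableEq F]
    (hF : ringChar F ≠ 2) (W : WeierstrassCurve F) (h1 : W.a₁ = 0) (h3 : W.a₃ = 0)
    (h6 : W.a₆ = 0) (h4 : W.a₄ ≠ 0) (hd : W.a₂ ^ 2 - 4 * W.a₄ ≠ 0) :
    (Nat.card W.toAffine.Point : ℤ) =
      1 + ∑ x, (quadraticChar F (x ^ 3 + W.a₂ * x ^ 2 + W.a₄ * x) + 1) := by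
  have h2 : (2 : F) ≠ 0 := Ring.two_ne_zero hF
  rw [← card_sq_eq_eq_sum_quadraticChar hF (fun x => x ^ 3 + W.a₂ * x ^ 2 + W.a₄ * x),
    show Nat.card W.toAffine.Point = _ from
      (Nat.card_congr W.toAffine.nonsingularPointEquiv).trans Finite.card_option]
  push_cast
  rw [add_comm]
  congr 2
  refine Nat.card_congr (Equiv.subtypeEquivRight fun P => ?_)
  refine ⟨fun h => ((nonsingular_iff_of_two_torsion_origin h2 W h1 h3 h6 _ _).1 h).1, fun h =>
    nonsingular_of_disc_ne_zero h2 W h1 h3 h6 h4 hd _ _ h⟩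

/-- The numbers of points of a curve and of its quadratic twist by a nonsquare add up to
`2 q + 2`. -/
theorem card_point_add_card_point_twist {F : Type*} [Field F] [Fintype F] [DecidableEq F]
    (hF : ringChar F ≠ 2) (W W' : WeierstrassCurve F) (h1 : W.a₁ = 0) (h3 : W.a₃ = 0)
    (h6 : W.a₆ = 0) (h4 : W.a₄ ≠ 0) (hd : W.a₂ ^ 2 - 4 * W.a₄ ≠ 0)
    (h1' : W'.a₁ = 0) (h3' : W'.a₃ = 0) (h6' : W'.a₆ = 0) (d : F)
    (hns : ¬ IsSquare d) (h2' : W'.a₂ = d * W.a₂) (h4' : W'.a₄ = d ^ 2 * W.a₄) :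
    Nat.card W.toAffine.Point + Nat.card W'.toAffine.Point = 2 * Fintype.card F + 2 := by
  have hd0 : d ≠ 0 := fun h => hns (h ▸ IsSquare.zero)
  zify
  rw [card_point_eq_sum_quadraticChar hF W h1 h3 h6 h4 hd,
    card_point_eq_sum_quadraticChar hF W' h1' h3' h6'
      (by rw [h4']; exact mul_ne_zero (pow_ne_zero _ hd0) h4)
      (by rw [h2', h4', show (d * W.a₂) ^ 2 - 4 * (d ^ 2 * W.a₄) =
            d ^ 2 * (W.a₂ ^ 2 - 4 * W.a₄) by ring]
          exact mul_ne_zero (pow_ne_zero _ hd0) hd)]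
  rw [← Equiv.sum_comp (Equiv.mulLeft₀ d hd0)
    (fun x => quadraticChar F (x ^ 3 + W'.a₂ * x ^ 2 + W'.a₄ * x) + 1)]
  have hχ : quadraticChar F d = -1 := quadraticChar_neg_one_iff_not_isSquare.2 hns
  have : ∀ x, quadraticChar F ((Equiv.mulLeft₀ d hd0 x) ^ 3 +
      W'.a₂ * (Equiv.mulLeft₀ d hd0 x) ^ 2 + W'.a₄ * (Equiv.mulLeft₀ d hd0 x)) + 1 =
      2 - (quadraticChar F (x ^ 3 + W.a₂ * x ^ 2 + W.a₄ * x) + 1) := by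
    intro x
    rw [Equiv.mulLeft₀_apply, h2', h4', show (d * x) ^ 3 + d * W.a₂ * (d * x) ^ 2 +
      d ^ 2 * W.a₄ * (d * x) = d ^ 3 * (x ^ 3 + W.a₂ * x ^ 2 + W.a₄ * x) by ring, map_mul, map_pow,
      hχ]
    ring
  simp only [this, Finset.sum_sub_distrib]
  simp
  ring

theorem three_dvd_card_point_of_threeDivision {F : Type*} [Field F] [Fintype F] [DecidableEq F]
    (h2 : (2 : F) ≠ 0) (W : WeierstrassCurve F) (h1 : W.a₁ = 0) (h3 : W.a₃ = 0)
    (h6 : W.a₆ = 0) (h4 : W.a₄ ≠ 0) (hd : W.a₂ ^ 2 - 4 * W.a₄ ≠ 0) (x y : F)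
    (hxy : y ^ 2 = x ^ 3 + W.a₂ * x ^ 2 + W.a₄ * x)
    (hx : threeDivision W.a₂ W.a₄ x = 0) : 3 ∣ Nat.card W.toAffine.Point := by
  have h := nonsingular_of_disc_ne_zero h2 W h1 h3 h6 h4 hd x y hxy
  have h3P := (three_nsmul_some_eq_zero_iff h2 W h1 h3 h6 x y h).2 hx
  have : Fact (Nat.Prime 3) := ⟨Nat.prime_three⟩
  rw [← addOrderOf_eq_prime h3P (WeierstrassCurve.Affine.Point.some_ne_zero h)]
  exact addOrderOf_dvd_natCard _

/-- If `q ≡ 1 mod 3` and `3 ∣ a_q(E)`, then the `3`-division polynomial has no root in `𝔽_q`. -/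
theorem threeDivision_ne_zero_of_three_dvd_trace {F : Type*} [Field F] [Fintype F] [DecidableEq F]
    (hF : ringChar F ≠ 2) (hq : Fintype.card F % 3 = 1)
    (W : WeierstrassCurve F) (h1 : W.a₁ = 0) (h3 : W.a₃ = 0)
    (h6 : W.a₆ = 0) (h4 : W.a₄ ≠ 0) (hd : W.a₂ ^ 2 - 4 * W.a₄ ≠ 0)
    (htr : (3 : ℤ) ∣ Fintype.card F + 1 - Nat.card W.toAffine.Point) (x : F) :
    threeDivision W.a₂ W.a₄ x ≠ 0 := by
  intro hx
  have h2 : (2 : F) ≠ 0 := Ring.two_ne_zero hF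
  set d := x ^ 3 + W.a₂ * x ^ 2 + W.a₄ * x with hdef
  -- If the cubic takes a square value d at x, the root x is the abscissa of a point of order 3 on
  -- `W`. Otherwise (dx, d²) is such a point on the twist by d. The trace is accordingly ≡ q + 1 or
  -- -(q + 1) mod 3, hence nonzero.
  by_cases hs : IsSquare d
  · obtain ⟨y, hy⟩ := hs
    have := three_dvd_card_point_of_threeDivision h2 W h1 h3 h6 h4 hd x y
      (by rw [← hdef, hy, sq]) hx
    omega
  · have hd0 : d ≠ 0 := fun h => hs (h ▸ IsSquare.zero)
    let W' : WeierstrassCurve F := ⟨0, d * W.a₂, 0, d ^ 2 * W.a₄, 0⟩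
    have hc := card_point_add_card_point_twist hF W W' h1 h3 h6 h4 hd rfl rfl rfl d hs rfl rfl
    have := three_dvd_card_point_of_threeDivision h2 W' rfl rfl rfl
      (mul_ne_zero (pow_ne_zero _ hd0) h4)
      (by
        change (d * W.a₂) ^ 2 - 4 * (d ^ 2 * W.a₄) ≠ 0
        rw [show (d * W.a₂) ^ 2 - 4 * (d ^ 2 * W.a₄) = d ^ 2 * (W.a₂ ^ 2 - 4 * W.a₄) by ring]
        exact mul_ne_zero (pow_ne_zero _ hd0) hd) (d * x) (d ^ 2)
      (by
        change (d ^ 2) ^ 2 = (d * x) ^ 3 + d * W.a₂ * (d * x) ^ 2 + d ^ 2 * W.a₄ * (d * x)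
        linear_combination d ^ 3 * hdef)
      (by
        change threeDivision (d * W.a₂) (d ^ 2 * W.a₄) (d * x) = 0
        simp only [threeDivision] at hx ⊢
        linear_combination d ^ 4 * hx)
    omega

/-! ### From ℚ(√-3) to 𝔽_p through ℚ_p -/

theorem exists_sq_eq_neg_three_zmod {p : ℕ} [Fact p.Prime] (hp : p % 3 = 1) :
    ∃ t : ZMod p, t ^ 2 = -3 := by
  have : Fact (Nat.Prime 3) := ⟨Nat.prime_three⟩
  have hd : 3 ∣ Nat.card (ZMod p)ˣ := by
    rw [Nat.card_eq_fintype_card, ZMod.card_units]; omega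
  obtain ⟨g, hg⟩ := exists_prime_orderOf_dvd_card' 3 hd
  have h3 : (g : ZMod p) ^ 3 = 1 := by
    rw [← Units.val_pow_eq_pow_val, ← hg, pow_orderOf_eq_one, Units.val_one]
  have h1 : (g : ZMod p) - 1 ≠ 0 := by
    intro h
    have : g = 1 := Units.ext (sub_eq_zero.1 h)
    rw [this, orderOf_one] at hg
    omega
  -- For g of order 3, g² + g + 1 = 0 and (2g + 1)² = 4(g² + g + 1) - 3.
  refine ⟨2 * g + 1, ?_⟩
  have : (g : ZMod p) ^ 2 + g + 1 = 0 := by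
    apply mul_left_cancel₀ h1
    linear_combination h3
  linear_combination 4 * this

/-- Hensel's lemma for X² + 3: at a root mod p the derivative 2s is a unit, since (2s)² = -12 and p
does not divide 12. -/
theorem exists_sq_eq_neg_three_padic {p : ℕ} [Fact p.Prime] (hp : p % 3 = 1) (hp2 : p ≠ 2) :
    ∃ t : ℤ_[p], t ^ 2 = -3 := by
  obtain ⟨t, ht⟩ := exists_sq_eq_neg_three_zmod hp
  obtain ⟨s, rfl⟩ := ZMod.ringHom_surjective (PadicInt.toZMod (p := p)) t
  have hprime : p.Prime := Fact.out
  have hmod : ∀ z : ℤ_[p], PadicInt.toZMod z = 0 ↔ ‖z‖ < 1 := fun z => by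
    rw [← RingHom.mem_ker, PadicInt.ker_toZMod, IsLocalRing.mem_maximalIdeal, PadicInt.mem_nonunits]
  let F : Polynomial ℤ_[p] := Polynomial.X ^ 2 + 3
  have hder : ‖F.derivative.aeval s‖ = 1 := by
    have h2 : PadicInt.toZMod (2 * s : ℤ_[p]) ≠ 0 := by
      intro h
      rw [map_mul, map_ofNat] at h
      have h' : (2 * PadicInt.toZMod s) ^ 2 = 0 := by rw [h]; ring
      rw [mul_pow, ht] at h'
      have h12 : ((12 : ℕ) : ZMod p) = 0 := by push_cast; linear_combination -h'
      rw [ZMod.natCast_eq_zero_iff] at h12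
      have : p ∣ 2 ^ 2 * 3 := h12
      rcases hprime.dvd_mul.1 this with h | h
      · exact hp2 ((Nat.prime_dvd_prime_iff_eq hprime Nat.prime_two).1 (hprime.dvd_of_dvd_pow h))
      · have := (Nat.prime_dvd_prime_iff_eq hprime Nat.prime_three).1 h
        omega
    rw [Ne, hmod, not_lt] at h2
    have : F.derivative.aeval s = 2 * s := by
      simp only [F, Polynomial.derivative_add, Polynomial.derivative_X_sq,
        Polynomial.derivative_ofNat, add_zero, map_mul, Polynomial.aeval_X, Polynomial.aeval_C]
      simp
    rw [this]
    exact le_antisymm (PadicInt.norm_le_one _) h2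
  have hF : ‖F.aeval s‖ < ‖F.derivative.aeval s‖ ^ 2 := by
    rw [hder, one_pow, ← hmod]
    have : F.aeval s = s ^ 2 + 3 := by simp [F]
    rw [this, map_add, map_pow, ht, map_ofNat]
    ring
  obtain ⟨z, hz, -⟩ := hensels_lemma hF
  refine ⟨z, ?_⟩
  have : F.aeval z = z ^ 2 + 3 := by simp [F]
  rw [this] at hz
  linear_combination hz

/-- A root in `ℚ_p` of the `3`-division polynomial with integral coefficients reduces to a root
in `𝔽_p`, when `p ≠ 3`. -/
theorem exists_threeDivision_root_zmod {p : ℕ} [Fact p.Prime] (hp3 : p ≠ 3) (a₂ a₄ : ℤ)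
    (r : ℚ_[p]) (hr : threeDivision (a₂ : ℚ_[p]) a₄ r = 0) :
    ∃ x : ZMod p, threeDivision (a₂ : ZMod p) a₄ x = 0 := by
  have hprime : p.Prime := Fact.out
  have h3 : ‖(3 : ℤ_[p])‖ = 1 := by
    have : ‖((3 : ℤ) : ℤ_[p])‖ = 1 := by
      refine le_antisymm (PadicInt.norm_le_one _) (not_lt.1 fun h => ?_)
      rw [PadicInt.norm_int_lt_one_iff_dvd] at h
      have h' : p ∣ 3 := by exact_mod_cast h
      exact hp3 ((Nat.prime_dvd_prime_iff_eq hprime Nat.prime_three).1 h')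
    simpa using this
  obtain ⟨u, hu⟩ := PadicInt.isUnit_iff.2 h3
  have hu3 : (3 : ℤ_[p]) * (↑u⁻¹ : ℤ_[p]) = 1 := by rw [← hu, Units.mul_inv]
  -- Since 3 is a unit of ℤ_p, the polynomial can be made monic; its roots in ℚ_p are then integral,
  -- and ℤ_p is integrally closed.
  have hint : IsIntegral ℤ_[p] r := by
    let v : ℤ_[p] := ↑u⁻¹
    refine ⟨Polynomial.X ^ 4 + (Polynomial.C (v * (4 * a₂)) * Polynomial.X ^ 3 +
      Polynomial.C (v * (6 * a₄)) * Polynomial.X ^ 2 + Polynomial.C (-(v * a₄ ^ 2))), ?_, ?_⟩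
    · apply Polynomial.monic_X_pow_add
      compute_degree!
    · have hv : (3 : ℚ_[p]) * (v : ℚ_[p]) = 1 := by
        have := congrArg (algebraMap ℤ_[p] ℚ_[p]) hu3
        rwa [map_mul, map_ofNat, map_one] at this
      have hm : ∀ z : ℤ_[p], algebraMap ℤ_[p] ℚ_[p] z = z := fun _ => rfl
      simp only [Polynomial.eval₂_add, Polynomial.eval₂_mul, Polynomial.eval₂_pow,
        Polynomial.eval₂_X, Polynomial.eval₂_C]
      simp only [map_mul, map_neg, map_pow, map_ofNat, map_intCast]
      simp only [hm]
      simp only [threeDivision] at hr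
      linear_combination (v : ℚ_[p]) * hr - r ^ 4 * hv
  obtain ⟨x, rfl⟩ := IsIntegrallyClosed.isIntegral_iff.1 hint
  refine ⟨PadicInt.toZMod x, ?_⟩
  have hx : threeDivision (a₂ : ℤ_[p]) a₄ x = 0 := by
    apply IsFractionRing.injective ℤ_[p] ℚ_[p]
    rw [map_zero, ← hr, map_threeDivision, map_intCast, map_intCast]
  have := congrArg (PadicInt.toZMod (p := p)) hx
  rwa [map_threeDivision, map_intCast, map_intCast, map_zero] at this

/-- The square roots of d are ±s, so the field is ℚ[s], and the elements u + vs are closed under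
products because s² = d. -/
theorem exists_eq_add_mul_of_mem_adjoin_sqrt {L : Type*} [Field L] [Algebra ℚ L]
    (d : ℤ) {r : L} (hr : r ∈ IntermediateField.adjoin ℚ {t : L | t ^ 2 = (d : L)})
    {s : L} (hs : s ^ 2 = d) : ∃ u v : ℚ, r = algebraMap ℚ L u + algebraMap ℚ L v * s := by
  have hset : {t : L | t ^ 2 = (d : L)} ⊆ (IntermediateField.adjoin ℚ {s} : Set L) := by
    intro t ht
    have hss : s ∈ IntermediateField.adjoin ℚ {s} := IntermediateField.mem_adjoin_simple_self ℚ s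
    rcases sq_eq_sq_iff_eq_or_eq_neg.1 (ht.trans hs.symm) with rfl | rfl
    · exact hss
    · exact neg_mem hss
  have hr' : r ∈ IntermediateField.adjoin ℚ {s} := IntermediateField.adjoin_le_iff.2 hset hr
  have hsint : IsIntegral ℚ s := by
    refine ⟨Polynomial.X ^ 2 - Polynomial.C (d : ℚ), Polynomial.monic_X_pow_sub_C _ two_ne_zero, ?_⟩
    rw [Polynomial.eval₂_sub, Polynomial.eval₂_pow, Polynomial.eval₂_X, Polynomial.eval₂_C, hs,
      map_intCast, sub_self]
  rw [← IntermediateField.mem_toSubalgebra,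
    IntermediateField.adjoin_simple_toSubalgebra_of_isAlgebraic hsint.isAlgebraic] at hr'
  clear hr
  induction hr' using Algebra.adjoin_induction with
  | mem x hx => exact ⟨0, 1, by simp [Set.mem_singleton_iff.1 hx]⟩
  | algebraMap x => exact ⟨x, 0, by simp⟩
  | add x y _ _ hx hy =>
    obtain ⟨a, b, rfl⟩ := hx
    obtain ⟨c, e, rfl⟩ := hy
    exact ⟨a + c, b + e, by simp only [map_add]; ring⟩
  | mul x y _ _ hx hy =>
    obtain ⟨a, b, rfl⟩ := hx
    obtain ⟨c, e, rfl⟩ := hy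
    refine ⟨a * c + b * e * d, a * e + b * c, ?_⟩
    simp only [map_add, map_mul, map_intCast]
    linear_combination algebraMap ℚ L b * algebraMap ℚ L e * hs

/-- If the `3`-division polynomial has no root in `𝔽_p`, `p ≡ 1 mod 3`, then it has no root in
`ℚ(√-3)`. -/
theorem threeDivision_ne_zero_of_mem_adjoin_sqrt {p : ℕ} [Fact p.Prime] (hp : p % 3 = 1)
    (hp2 : p ≠ 2) (a₂ a₄ : ℤ)
    (h : ∀ x : ZMod p, threeDivision (a₂ : ZMod p) a₄ x ≠ 0) {L : Type*} [Field L] [Algebra ℚ L]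
    [IsAlgClosed L] [Algebra.IsAlgebraic ℚ L] {r : L}
    (hr : r ∈ IntermediateField.adjoin ℚ {t : L | t ^ 2 = ((-3 : ℤ) : L)}) :
    threeDivision (a₂ : L) a₄ r ≠ 0 := by
  intro h0
  obtain ⟨s, hs⟩ := IsAlgClosed.exists_pow_nat_eq ((-3 : ℤ) : L) two_pos
  obtain ⟨u, v, rfl⟩ := exists_eq_add_mul_of_mem_adjoin_sqrt _ hr hs
  obtain ⟨t, ht⟩ := exists_sq_eq_neg_three_padic hp hp2
  -- Any embedding will do: it sends s to a square root of -3, which is ±t and so lies in ℚ_p,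
  -- together with the image of u + vs.
  let φ : L →ₐ[ℚ] AlgebraicClosure ℚ_[p] := IsAlgClosed.lift
  have hφs : φ s ^ 2 = (algebraMap ℚ_[p] (AlgebraicClosure ℚ_[p]) (t : ℚ_[p])) ^ 2 := by
    rw [← map_pow, hs, ← map_pow, ← PadicInt.coe_pow, ht]
    rw [map_intCast, PadicInt.coe_neg, map_neg, Int.cast_neg, Int.cast_ofNat]
    exact congrArg _ (map_ofNat (algebraMap ℚ_[p] (AlgebraicClosure ℚ_[p])) 3).symm
  obtain ⟨w, hw⟩ : ∃ w : ℚ_[p], φ s = algebraMap ℚ_[p] (AlgebraicClosure ℚ_[p]) w := by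
    rcases sq_eq_sq_iff_eq_or_eq_neg.1 hφs with h | h
    · exact ⟨t, h⟩
    · exact ⟨-t, by rw [h, map_neg]⟩
  obtain ⟨x, hx⟩ := exists_threeDivision_root_zmod (p := p) (by rintro rfl; omega) a₂ a₄
    ((u : ℚ_[p]) + v * w) (by
      apply (algebraMap ℚ_[p] (AlgebraicClosure ℚ_[p])).injective
      have := congrArg φ h0
      rw [map_zero] at this ⊢
      have h' := map_threeDivision (φ : L →+* AlgebraicClosure ℚ_[p]) a₂ a₄
        (algebraMap ℚ L u + algebraMap ℚ L v * s)
      simp only [RingHom.coe_coe, map_intCast, map_add, map_mul, hw, AlgHom.commutes] at h' this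
      rw [this] at h'
      rw [h', map_threeDivision]
      simp)
  exact h x hx

/-! ### Absolute irreducibility from a transvection -/

/-- A representation on a plane spanned by `e₁, e₂`, containing the transvection
`e₁ ↦ e₁, e₂ ↦ e₁ + e₂`, is absolutely irreducible as soon as it does not stabilise the line of
`e₁`. -/
theorem isAbsolutelyIrreducible_of_transvection {k G V : Type*} [Field k] [Monoid G]
    [AddCommGroup V] [Module k V] (ρ : Representation k G V) (e₁ e₂ : V) (he₁ : e₁ ≠ 0)
    (hspan : ∀ v, ∃ a b : k, v = a • e₁ + b • e₂) (g : G) (hg₁ : ρ g e₁ = e₁)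
    (hg₂ : ρ g e₂ = e₁ + e₂) (h : G) (hh : ∀ s : k, ρ h e₁ ≠ s • e₁) :
    IsAbsolutelyIrreducible ρ := by
  let K := AlgebraicClosure k
  have hact : ∀ (x : G) (c : K) (v : V), repBaseChange K ρ x (c ⊗ₜ v) = c ⊗ₜ ρ x v :=
    fun x c v => rfl
  have hbasis : ∀ w : K ⊗[k] V, ∃ α β : K, w = α ⊗ₜ e₁ + β ⊗ₜ e₂ := by
    intro w
    induction w with
    | zero => exact ⟨0, 0, by simp⟩
    | tmul c v =>
      obtain ⟨a, b, rfl⟩ := hspan v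
      exact ⟨a • c, b • c, by simp only [TensorProduct.tmul_add, TensorProduct.tmul_smul,
        TensorProduct.smul_tmul']⟩
    | add x y hx hy =>
      obtain ⟨a, b, rfl⟩ := hx
      obtain ⟨c, d, rfl⟩ := hy
      exact ⟨a + c, b + d, by simp only [TensorProduct.add_tmul]; abel⟩
  have hscale : ∀ (L : Submodule K (K ⊗[k] V)) (c : K) (v : V), c ≠ 0 → c ⊗ₜ[k] v ∈ L →
      ∀ d : K, d ⊗ₜ[k] v ∈ L := by
    intro L c v hc hL d
    have := L.smul_mem (d * c⁻¹) hL
    rwa [TensorProduct.smul_tmul', smul_eq_mul, mul_assoc, inv_mul_cancel₀ hc, mul_one] at this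
  have hne : (1 : K) ⊗ₜ[k] e₁ ≠ 0 := by
    intro h0
    apply he₁
    apply Module.FaithfullyFlat.tensorProduct_mk_injective (A := k) (B := K) V
    rw [map_zero]
    exact h0
  change IsSimpleOrder (Subrepresentation (repBaseChange K ρ))
  refine { exists_pair_ne := ⟨⊥, ⊤, fun hbt => hne ?_⟩, eq_bot_or_eq_top := fun L => ?_ }
  · have : (1 : K) ⊗ₜ[k] e₁ ∈ (⊤ : Subrepresentation (repBaseChange K ρ)).toSubmodule :=
      Submodule.mem_top
    rw [← hbt] at this
    exact (Submodule.mem_bot K).1 this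
  · by_cases hL : L.toSubmodule = ⊥
    · exact Or.inl (Subrepresentation.toSubmodule_injective hL)
    refine Or.inr (Subrepresentation.toSubmodule_injective ?_)
    change L.toSubmodule = ⊤
    -- For w = αe₁ + βe₂ one has (g - 1)w = βe₁. Hence a nonzero stable subspace contains e₁, and
    -- applying h to e₁ then produces e₂.
    obtain ⟨w, hw, hw0⟩ := Submodule.exists_mem_ne_zero_of_ne_bot hL
    obtain ⟨α, β, rfl⟩ := hbasis w
    have h1 : ∀ d : K, d ⊗ₜ[k] e₁ ∈ L.toSubmodule := by
      by_cases hβ : β = 0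
      · subst hβ
        rw [TensorProduct.zero_tmul, add_zero] at hw hw0
        exact hscale _ α _ (by rintro rfl; simp at hw0) hw
      · refine hscale _ β _ hβ ?_
        have := L.toSubmodule.sub_mem (L.apply_mem_toSubmodule g hw) hw
        rw [map_add, hact, hact, hg₁, hg₂, TensorProduct.tmul_add] at this
        convert this using 1
        abel
    have h2 : ∀ d : K, d ⊗ₜ[k] e₂ ∈ L.toSubmodule := by
      obtain ⟨a, b, hab⟩ := hspan (ρ h e₁)
      have hb : b ≠ 0 := by
        rintro rfl
        exact hh a (by rw [hab, zero_smul, add_zero])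
      have := L.apply_mem_toSubmodule h (h1 1)
      rw [hact, hab, TensorProduct.tmul_add, TensorProduct.tmul_smul, TensorProduct.tmul_smul,
        TensorProduct.smul_tmul', TensorProduct.smul_tmul'] at this
      have := L.toSubmodule.sub_mem this (h1 (a • 1))
      rw [add_sub_cancel_left] at this
      exact hscale _ _ _ (smul_ne_zero hb one_ne_zero) this
    rw [eq_top_iff]
    intro w _
    obtain ⟨α, β, rfl⟩ := hbasis w
    exact L.toSubmodule.add_mem (h1 α) (h2 β)

/-- If no such vector exists, N²v = 0 implies Nv = 0, and the exponent n in Nⁿ = 0 can be lowered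
until N = 0. -/
theorem exists_jordan_pair_of_isNilpotent {k V : Type*} [Field k] [AddCommGroup V] [Module k V]
    (N : Module.End k V) (hN : IsNilpotent N) (h0 : N ≠ 0) :
    ∃ e₂ : V, N e₂ ≠ 0 ∧ N (N e₂) = 0 := by
  by_contra! hc
  obtain ⟨n, hn⟩ := hN
  apply h0
  induction n with
  | zero =>
    have : (1 : Module.End k V) = 0 := by rwa [pow_zero] at hn
    rw [← mul_one N, this, mul_zero]
  | succ n ih =>
    rcases n with _ | n
    · simpa using hn
    · apply ih
      ext v
      have hv := LinearMap.congr_fun hn v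
      rw [pow_succ', pow_succ', Module.End.mul_apply, Module.End.mul_apply] at hv
      rw [pow_succ', Module.End.mul_apply]
      by_contra hne
      exact hc _ hne hv

/-- A mod `p` representation on a space with at most `p²` elements, whose image contains an element
of order divisible by `p`, and which stabilises no line, is absolutely irreducible. -/
theorem isAbsolutelyIrreducible_of_card_le {p : ℕ} [Fact p.Prime] {G V : Type*} [Group G]
    [AddCommGroup V] [Module (ZMod p) V] [Finite V] (hcard : Nat.card V ≤ p ^ 2)
    (ρ : Representation (ZMod p) G V) (g : G) (hg : ∀ m, ¬ p ∣ m → ρ (g ^ m) ≠ 1)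
    (hline : ∀ v : V, v ≠ 0 → ∃ h, ∀ s : ZMod p, ρ h v ≠ s • v) :
    IsAbsolutelyIrreducible ρ := by
  have hprime : p.Prime := Fact.out
  have : Finite (Module.End (ZMod p) V) := DFunLike.finite _
  have hpos : orderOf (ρ.toHomUnits g) ≠ 0 := (orderOf_pos _).ne'
  obtain ⟨j, m, hm, hjm⟩ := Nat.exists_eq_pow_mul_and_not_dvd hpos p hprime.ne_one
  -- With m the prime-to-p part of the order, T has p-power order. In characteristic p this makes T
  -- - 1 nilpotent, as (T - 1)^(p^j) = T^(p^j) - 1 = 0.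
  set T : Module.End (ZMod p) V := ρ (g ^ m) with hT
  have hT1 : T ≠ 1 := hg m hm
  have hTp : T ^ p ^ j = 1 := by
    have h1 : ρ.toHomUnits (g ^ (p ^ j * m)) = 1 := by
      rw [map_pow, ← hjm, pow_orderOf_eq_one]
    rw [hT, ← map_pow, ← pow_mul, mul_comm m]
    exact congrArg Units.val h1
  have hNz : T - 1 ≠ 0 := sub_ne_zero.2 hT1
  have hnt : Nontrivial (Module.End (ZMod p) V) := ⟨T, 1, hT1⟩
  have : CharP (Module.End (ZMod p) V) p := charP_of_injective_algebraMap
    (algebraMap (ZMod p) (Module.End (ZMod p) V)).injective p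
  have hNnil : IsNilpotent (T - 1) :=
    ⟨p ^ j, by rw [sub_pow_char_pow_of_commute p j (Commute.one_right T), hTp, one_pow, sub_self]⟩
  obtain ⟨e₂, h1, h2⟩ := exists_jordan_pair_of_isNilpotent _ hNnil hNz
  set e₁ := (T - 1) e₂ with he₁
  obtain ⟨h, hh⟩ := hline e₁ h1
  -- The Jordan pair is independent, so it spans p² vectors; the upper bound on the cardinality
  -- makes it a basis.
  have hinj : Function.Injective (fun x : ZMod p × ZMod p => x.1 • e₁ + x.2 • e₂) := by
    rintro ⟨a, b⟩ ⟨c, d⟩ hx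
    simp only at hx
    have hb := congrArg (T - 1 : Module.End (ZMod p) V) hx
    simp only [map_add, map_smul, h2, ← he₁, smul_zero, zero_add] at hb
    have hbd : b = d := smul_left_injective _ h1 hb
    subst hbd
    have hac : a = c := smul_left_injective _ h1 (add_right_cancel hx)
    rw [hac]
  have hsurj : Function.Surjective (fun x : ZMod p × ZMod p => x.1 • e₁ + x.2 • e₂) := by
    refine ((Nat.bijective_iff_injective_and_card _).2 ⟨hinj, le_antisymm ?_ ?_⟩).2
    · exact Nat.card_le_card_of_injective _ hinj
    · rwa [Nat.card_prod, Nat.card_zmod, ← sq]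
  refine isAbsolutelyIrreducible_of_transvection ρ e₁ e₂ h1 (fun v => ?_) (g ^ m) ?_ ?_ h hh
  · obtain ⟨⟨a, b⟩, hab⟩ := hsurj v
    exact ⟨a, b, hab.symm⟩
  · rw [LinearMap.sub_apply, sub_eq_zero] at h2
    exact h2
  · rw [he₁, LinearMap.sub_apply, Module.End.one_apply, sub_add_cancel]

/-! ### The resolvent cubic and cubes in ℚ(√-3) -/

theorem exists_threeDivision_eq_prod {L : Type*} [Field L] [CharZero L] [IsAlgClosed L]
    (a₂ a₄ : L) : ∃ x : Fin 4 → L, ∀ t, threeDivision a₂ a₄ t = 3 * ∏ i, (t - x i) := by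
  let P : Polynomial L := Polynomial.C 3 * Polynomial.X ^ 4 +
    Polynomial.C (4 * a₂) * Polynomial.X ^ 3 + Polynomial.C (6 * a₄) * Polynomial.X ^ 2 -
    Polynomial.C (a₄ ^ 2)
  have hdeg : P.natDegree = 4 := by
    simp only [P]
    compute_degree!
  have hlead : P.leadingCoeff = 3 := by
    rw [Polynomial.leadingCoeff, hdeg]
    simp only [P, Polynomial.coeff_sub, Polynomial.coeff_add, Polynomial.coeff_C_mul,
      Polynomial.coeff_X_pow, Polynomial.coeff_C]
    norm_num
  have hs := IsAlgClosed.splits P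
  have hcard : P.roots.card = 4 := by rw [← hs.natDegree_eq_card_roots, hdeg]
  have hprod := hs.eq_prod_roots
  rw [hlead] at hprod
  obtain ⟨l, hl⟩ := Quot.exists_rep P.roots
  have hl' : P.roots = (l : Multiset L) := hl.symm
  rw [hl'] at hprod hcard
  rw [Multiset.coe_card] at hcard
  refine ⟨fun i => l.get (i.cast hcard.symm), fun t => ?_⟩
  have : P.eval t = threeDivision a₂ a₄ t := by simp [P, threeDivision]
  rw [← this, hprod]
  match l, hcard with
  | [a, b, c, d], _ =>
    simp [Fin.prod_univ_four, mul_assoc]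

/-- The resolvent cubic of the `3`-division polynomial is the equation `c³ = Δ`. -/
theorem resolvent_cube_eq {L : Type*} [Field L] [CharZero L] {a₂ a₄ : L} {x : Fin 4 → L}
    (hx : ∀ t, threeDivision a₂ a₄ t = 3 * ∏ i, (t - x i)) :
    (2 * a₄ - 3 * (x 0 * x 1 + x 2 * x 3)) ^ 3 = 16 * a₄ ^ 2 * (a₂ ^ 2 - 4 * a₄) := by
  simp only [Fin.prod_univ_four, threeDivision] at hx
  -- Four values determine the elementary symmetric functions of the roots, the leading coefficient
  -- being known.
  have q0 := hx 0
  have q1 := hx 1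
  have qm := hx (-1)
  have q2 := hx 2
  generalize x 0 = p at *
  generalize x 1 = q at *
  generalize x 2 = r at *
  generalize x 3 = s at *
  have e4 : 3 * (p * q * r * s) = -a₄ ^ 2 := by linear_combination -q0
  have e2 : p * q + p * r + p * s + q * r + q * s + r * s = 2 * a₄ := by
    linear_combination (-q1 / 2 - qm / 2 + q0) / 3
  have e1 : 3 * (p + q + r + s) = -4 * a₂ := by
    linear_combination (q2 - 3 * q1 - qm + 3 * q0) / 6
  have e3 : p * q * r + p * q * s + p * r * s + q * r * s = 0 := by
    linear_combination (((q1 - qm) / 2 - (q2 - 3 * q1 - qm + 3 * q0) / 6)) / 3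
  -- This is the resolvent cubic at θ = pq + rs. Its θ² and θ terms are those of (θ - 2a₄/3)³, so
  -- the substitution c = 2a₄ - 3θ leaves a pure cube.
  have hres : (p * q + r * s) ^ 3 - 2 * a₄ * (p * q + r * s) ^ 2
      + 4 * a₄ ^ 2 / 3 * (p * q + r * s) + 16 * a₂ ^ 2 * a₄ ^ 2 / 27 - 8 * a₄ ^ 3 / 3 = 0 := by
    have f4 : p * q * r * s = -a₄ ^ 2 / 3 := by linear_combination e4 / 3
    have f1 : p + q + r + s = -4 * a₂ / 3 := by linear_combination e1 / 3
    have gen : (p * q + r * s) ^ 3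
        - (p * q + p * r + p * s + q * r + q * s + r * s) * (p * q + r * s) ^ 2
        + ((p + q + r + s) * (p * q * r + p * q * s + p * r * s + q * r * s)
          - 4 * (p * q * r * s)) * (p * q + r * s)
        - ((p * q * r + p * q * s + p * r * s + q * r * s) ^ 2
          + (p + q + r + s) ^ 2 * (p * q * r * s)
          - 4 * (p * q + p * r + p * s + q * r + q * s + r * s) * (p * q * r * s)) = 0 := by
      ring
    rw [e2, e3, f4, f1] at gen
    linear_combination gen
  linear_combination -27 * hres

/-- Write c = u + vs with s² = -3. Rationality of c³ gives v(u² - v²) = 0, so c is u or u(1 ± s),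
which is -2u times a cube root of unity. -/
theorem exists_cube_root_rat_of_mem_adjoin_sqrt_neg_three {L : Type*} [Field L] [Algebra ℚ L]
    [IsAlgClosed L] {c : L} (hc : c ∈ IntermediateField.adjoin ℚ {t : L | t ^ 2 = ((-3 : ℤ) : L)})
    {q : ℚ} (hq : c ^ 3 = algebraMap ℚ L q) : ∃ t : ℚ, t ^ 3 = q := by
  have hinj := (algebraMap ℚ L).injective
  obtain ⟨s, hs⟩ := IsAlgClosed.exists_pow_nat_eq ((-3 : ℤ) : L) two_pos
  obtain ⟨u, v, rfl⟩ := exists_eq_add_mul_of_mem_adjoin_sqrt _ hc hs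
  push_cast at hs
  have h1 : algebraMap ℚ L (u ^ 3 - 9 * u * v ^ 2 - q) +
      algebraMap ℚ L (3 * v * (u ^ 2 - v ^ 2)) * s = 0 := by
    simp only [map_sub, map_mul, map_pow, map_ofNat]
    linear_combination hq - (3 * algebraMap ℚ L u * algebraMap ℚ L v ^ 2 +
      algebraMap ℚ L v ^ 3 * s) * hs
  have h2 : 3 * v * (u ^ 2 - v ^ 2) = 0 := by
    by_contra hne
    set m := 3 * v * (u ^ 2 - v ^ 2) with hm
    set n := u ^ 3 - 9 * u * v ^ 2 - q with hn
    have hsq : n ^ 2 + 3 * m ^ 2 = 0 := by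
      apply hinj
      simp only [map_add, map_mul, map_pow, map_ofNat, map_zero]
      linear_combination (algebraMap ℚ L n - algebraMap ℚ L m * s) * h1 +
        algebraMap ℚ L m ^ 2 * hs
    have : 0 < m ^ 2 := by positivity
    nlinarith [sq_nonneg n]
  rw [h2, map_zero, zero_mul, add_zero, map_eq_zero] at h1
  have h3 : v * ((u - v) * (u + v)) = 0 := by linear_combination h2 / 3
  rcases mul_eq_zero.1 h3 with h | h
  · exact ⟨u, by rw [h] at h1; linear_combination h1⟩
  have h4 : v ^ 2 = u ^ 2 := by linear_combination -h
  exact ⟨-2 * u, by linear_combination h1 + 9 * u * h4⟩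

/-! ### The 3-torsion over an algebraically closed field -/

section Torsion

variable {L : Type*} [Field L] [DecidableEq L]

theorem exists_torsion_point_of_threeDivision [IsAlgClosed L] (h2 : (2 : L) ≠ 0)
    (W : WeierstrassCurve L) (h1 : W.a₁ = 0) (h3 : W.a₃ = 0) (h6 : W.a₆ = 0) (h4 : W.a₄ ≠ 0)
    (hd : W.a₂ ^ 2 - 4 * W.a₄ ≠ 0) {x : L} (hx : threeDivision W.a₂ W.a₄ x = 0) :
    ∃ (y : L) (h : W.toAffine.Nonsingular x y),
      3 • WeierstrassCurve.Affine.Point.some x y h = 0 := by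
  obtain ⟨y, hy⟩ := IsAlgClosed.exists_pow_nat_eq (x ^ 3 + W.a₂ * x ^ 2 + W.a₄ * x) two_pos
  have h := nonsingular_of_disc_ne_zero h2 W h1 h3 h6 h4 hd x y hy
  exact ⟨y, h, (three_nsmul_some_eq_zero_iff h2 W h1 h3 h6 x y h).2 hx⟩

/-- There are at most nine `3`-torsion points. -/
theorem finite_and_card_le_of_three_nsmul_eq_zero [CharZero L] [IsAlgClosed L]
    (W : WeierstrassCurve L) (h1 : W.a₁ = 0) (h3 : W.a₃ = 0) (h6 : W.a₆ = 0) (h4 : W.a₄ ≠ 0)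
    (hd : W.a₂ ^ 2 - 4 * W.a₄ ≠ 0) (V : AddSubgroup W.toAffine.Point)
    (hV : ∀ P, P ∈ V ↔ 3 • P = 0) : Finite V ∧ Nat.card V ≤ 9 := by
  have h2 : (2 : L) ≠ 0 := two_ne_zero
  obtain ⟨x, hx⟩ := exists_threeDivision_eq_prod W.a₂ W.a₄
  have hroot : ∀ i, threeDivision W.a₂ W.a₄ (x i) = 0 := fun i => by
    rw [hx, Finset.prod_eq_zero (Finset.mem_univ i) (sub_self _), mul_zero]
  choose y hy hP using fun i =>
    exists_torsion_point_of_threeDivision h2 W h1 h3 h6 h4 hd (hroot i)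
  let P : Fin 4 → V := fun i => ⟨.some (x i) (y i) (hy i), (hV _).2 (hP i)⟩
  -- The origin and two opposite points over each of four abscissas: 1 + 4·2 = 9.
  let f : Option (Fin 4 × Bool) → V
    | none => 0
    | some (i, true) => P i
    | some (i, false) => -P i
  have hf : Function.Surjective f := by
    rintro ⟨_ | ⟨s, t, hst⟩, hQ⟩
    · exact ⟨none, rfl⟩
    · have hs := (three_nsmul_some_eq_zero_iff h2 W h1 h3 h6 s t hst).1 ((hV _).1 hQ)
      rw [hx, mul_eq_zero, Finset.prod_eq_zero_iff] at hs
      obtain ⟨i, -, hi⟩ := hs.resolve_left three_ne_zero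
      rw [sub_eq_zero] at hi
      rcases (WeierstrassCurve.Affine.Point.X_eq_iff (h₁ := hst) (h₂ := hy i)).1 hi with h | h
      · exact ⟨some (i, true), Subtype.ext h.symm⟩
      · exact ⟨some (i, false), Subtype.ext h.symm⟩
  refine ⟨Finite.of_surjective f hf, (Nat.card_le_card_of_surjective f hf).trans ?_⟩
  simp

end Torsion

/-! ### Arithmetic of the Eisenstein integers -/

/-- The ring `ℤ[ω]` of Eisenstein integers, with `ω² + ω + 1 = 0`. -/
abbrev EisensteinInt : Type := QuadraticAlgebra ℤ (-1) (-1)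

namespace EisensteinInt

theorem norm_eq (z : EisensteinInt) :
    QuadraticAlgebra.norm z = z.re ^ 2 - z.re * z.im + z.im ^ 2 := by
  rw [QuadraticAlgebra.norm_def]; ring

theorem norm_nonneg (z : EisensteinInt) : 0 ≤ QuadraticAlgebra.norm z := by
  rw [norm_eq]
  nlinarith [sq_nonneg (2 * z.re - z.im), sq_nonneg z.im]

theorem norm_pos {z : EisensteinInt} (hz : z ≠ 0) : 0 < QuadraticAlgebra.norm z := by
  refine lt_of_le_of_ne (norm_nonneg z) fun h => hz ?_
  rw [norm_eq] at h
  have h1 : z.im = 0 := by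
    have : z.im ^ 2 ≤ 0 := by nlinarith [sq_nonneg (2 * z.re - z.im)]
    exact pow_eq_zero_iff two_ne_zero |>.1 (le_antisymm this (sq_nonneg _))
  have h2 : z.re = 0 := by
    rw [h1] at h
    exact pow_eq_zero_iff two_ne_zero |>.1 (by linear_combination -h)
  exact QuadraticAlgebra.ext h2 h1

instance : IsDomain EisensteinInt :=
  have : NoZeroDivisors EisensteinInt := ⟨fun {x y} h => by
    by_contra! hc
    have := mul_pos (norm_pos hc.1) (norm_pos hc.2)
    rw [← map_mul, h, QuadraticAlgebra.norm_zero] at this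
    exact lt_irrefl _ this⟩
  NoZeroDivisors.to_isDomain _

theorem exists_abs_two_mul_sub_le (u : ℤ) {n : ℤ} (hn : 0 < n) :
    ∃ q : ℤ, |2 * (u - q * n)| ≤ n := by
  refine ⟨(2 * u + n) / (2 * n), ?_⟩
  have h1 := Int.mul_ediv_add_emod (2 * u + n) (2 * n)
  have h2 := Int.emod_nonneg (2 * u + n) (b := 2 * n) (by omega)
  have h3 := Int.emod_lt_of_pos (2 * u + n) (b := 2 * n) (by omega)
  rw [abs_le]
  constructor <;> linarith

/-- Rounding both coordinates of x/y leaves errors s, t of size at most 1/2, whose norm s² - st + t²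
is at most 3/4. -/
theorem exists_norm_sub_mul_lt (x : EisensteinInt) {y : EisensteinInt} (hy : y ≠ 0) :
    ∃ q : EisensteinInt, QuadraticAlgebra.norm (x - y * q) < QuadraticAlgebra.norm y := by
  have hn := norm_pos hy
  set n := QuadraticAlgebra.norm y with hndef
  obtain ⟨q₁, h₁⟩ := exists_abs_two_mul_sub_le (x * star y).re hn
  obtain ⟨q₂, h₂⟩ := exists_abs_two_mul_sub_le (x * star y).im hn
  refine ⟨⟨q₁, q₂⟩, ?_⟩
  have hmul : (x - y * ⟨q₁, q₂⟩) * star y =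
      ⟨(x * star y).re - q₁ * n, (x * star y).im - q₂ * n⟩ := by
    have hyy : y * star y = algebraMap ℤ EisensteinInt n :=
      (QuadraticAlgebra.algebraMap_norm_eq_mul_star y).symm
    rw [sub_mul, mul_right_comm, hyy, ← Algebra.smul_def]
    ext <;> simp [mul_comm]
  have hN := congrArg QuadraticAlgebra.norm hmul
  rw [map_mul, QuadraticAlgebra.norm_star, ← hndef] at hN
  rw [abs_le] at h₁ h₂
  generalize (x * star y).re - q₁ * n = s at *
  generalize (x * star y).im - q₂ * n = t at *
  have hs : (2 * s) ^ 2 ≤ n ^ 2 := sq_le_sq' h₁.1 h₁.2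
  have ht : (2 * t) ^ 2 ≤ n ^ 2 := sq_le_sq' h₂.1 h₂.2
  have hb : 4 * (QuadraticAlgebra.norm (x - y * ⟨q₁, q₂⟩) * n) ≤ 3 * n ^ 2 := by
    rw [hN, norm_eq]
    change 4 * (s ^ 2 - s * t + t ^ 2) ≤ 3 * n ^ 2
    nlinarith [sq_nonneg (s + t)]
  by_contra! hle
  nlinarith

instance : IsPrincipalIdealRing EisensteinInt := by
  classical
  have hex : ∀ x y : EisensteinInt, ∃ q, y ≠ 0 →
      QuadraticAlgebra.norm (x - y * q) < QuadraticAlgebra.norm y := fun x y => by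
    by_cases hy : y = 0
    · exact ⟨0, fun h => absurd hy h⟩
    · obtain ⟨q, hq⟩ := exists_norm_sub_mul_lt x hy
      exact ⟨q, fun _ => hq⟩
  choose q hq using hex
  let : EuclideanDomain EisensteinInt :=
    { (inferInstance : CommRing EisensteinInt), (inferInstance : Nontrivial EisensteinInt) with
      quotient := fun x y => if y = 0 then 0 else q x y
      quotient_zero := fun x => if_pos rfl
      remainder := fun x y => x - y * if y = 0 then 0 else q x y
      quotient_mul_add_remainder_eq := fun x y => by ring
      r := fun x y => (QuadraticAlgebra.norm x).natAbs < (QuadraticAlgebra.norm y).natAbs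
      r_wellFounded := (measure fun x : EisensteinInt => (QuadraticAlgebra.norm x).natAbs).wf
      remainder_lt := fun x y hy => by
        rw [if_neg hy]
        have := hq x y hy
        have := norm_nonneg (x - y * q x y)
        omega
      mul_left_not_lt := fun x y hy => by
        rw [map_mul, Int.natAbs_mul, not_lt]
        exact Nat.le_mul_of_pos_right _ (Int.natAbs_pos.2 (norm_pos hy).ne') }
  exact EuclideanDomain.to_principal_ideal_domain

theorem unit_cases (u : EisensteinIntˣ) :
    ∃ e : ℤ, (e = 1 ∨ e = -1) ∧ ((u : EisensteinInt) = ⟨e, 0⟩ ∨ (u : EisensteinInt) = ⟨0, e⟩ ∨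
      (u : EisensteinInt) = ⟨e, e⟩) := by
  have h1 : QuadraticAlgebra.norm (u : EisensteinInt) = 1 := by
    have h := QuadraticAlgebra.isUnit_iff_norm_isUnit.1 u.isUnit
    rcases Int.isUnit_iff.1 h with h | h
    · exact h
    · have := norm_nonneg (u : EisensteinInt)
      omega
  rw [norm_eq] at h1
  generalize (u : EisensteinInt) = w at h1 ⊢
  obtain ⟨a, b⟩ := w
  simp only at h1
  have hb : b ^ 2 ≤ 1 := by nlinarith [sq_nonneg (2 * a - b)]
  have ha : a ^ 2 ≤ 1 := by nlinarith [sq_nonneg (2 * b - a)]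
  obtain ⟨hb1, hb2⟩ := abs_le.1 ((sq_le_one_iff_abs_le_one b).1 hb)
  obtain ⟨ha1, ha2⟩ := abs_le.1 ((sq_le_one_iff_abs_le_one a).1 ha)
  interval_cases a <;> interval_cases b <;> simp_all

/-- Up to a cube root of unity, an Eisenstein integer lies in `ℤ[√-3]`. -/
theorem exists_cube_eq (d : EisensteinInt) :
    ∃ m n : ℤ, d ^ 3 = (⟨m + n, 2 * n⟩ : EisensteinInt) ^ 3 := by
  obtain ⟨a, b⟩ := d
  -- Elements m + n√-3 are those with even ω-coordinate. The three cases use d, ω²d and ωd.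
  rcases Int.even_or_odd' b with ⟨k, rfl | rfl⟩
  · exact ⟨a - k, k, by rw [sub_add_cancel]⟩
  rcases Int.even_or_odd' a with ⟨l, rfl | rfl⟩
  · refine ⟨2 * k + 1 - l, -l, ?_⟩
    ext <;> simp [pow_succ] <;> ring
  · refine ⟨-(2 * k + 1) - (l - k), l - k, ?_⟩
    ext <;> simp [pow_succ] <;> ring

end EisensteinInt

/-! ### Euler's equation α³ + β³ = 2γ³ by descent -/

/-- The factors a ± b√-3 in ℤ[ω] are coprime, as their sum 2a is prime to their product. Hence a +
b√-3 is a unit times a cube, and the cube may be taken as (m + n√-3)³. -/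
theorem exists_of_sq_add_three_mul_sq_eq_cube {a b s : ℤ} (hab : IsCoprime a b)
    (hodd : Odd (a + b)) (h3 : ¬ (3 : ℤ) ∣ a) (h : a ^ 2 + 3 * b ^ 2 = s ^ 3) :
    ∃ m n : ℤ, a = m * (m ^ 2 - 9 * n ^ 2) ∧ b = 3 * n * (m ^ 2 - n ^ 2) := by
  have hodd2 : Odd (a ^ 2 + 3 * b ^ 2) := by
    have : a ^ 2 + 3 * b ^ 2 = (a + b) ^ 2 + 2 * (b ^ 2 - a * b) := by ring
    rw [this]
    exact hodd.pow.add_even (even_two_mul _)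
  have hcop : IsCoprime (2 * a) (a ^ 2 + 3 * b ^ 2) := by
    refine IsCoprime.mul_left ?_ ?_
    · exact (Int.isCoprime_two_left).2 hodd2
    · have h3a : IsCoprime a 3 := ((Int.prime_three.coprime_iff_not_dvd).2 h3).symm
      have := (h3a.mul_right (hab.pow_right (n := 2))).add_mul_left_right a
      rwa [show 3 * b ^ 2 + a * a = a ^ 2 + 3 * b ^ 2 by ring] at this
  let z : EisensteinInt := ⟨a + b, 2 * b⟩
  let z' : EisensteinInt := ⟨a - b, -(2 * b)⟩
  have hsum : z + z' = ((2 * a : ℤ) : EisensteinInt) := by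
    ext
    · rw [QuadraticAlgebra.re_add, QuadraticAlgebra.re_intCast, Int.cast_id]; simp only [z, z']; ring
    · rw [QuadraticAlgebra.im_add, QuadraticAlgebra.im_intCast]; simp only [z, z']; ring
  have hprod : z * z' = ((a ^ 2 + 3 * b ^ 2 : ℤ) : EisensteinInt) := by
    ext
    · rw [QuadraticAlgebra.re_mul, QuadraticAlgebra.re_intCast, Int.cast_id]; simp only [z, z']; ring
    · rw [QuadraticAlgebra.im_mul, QuadraticAlgebra.im_intCast]; simp only [z, z']; ring
  have hzz : IsCoprime z z' := by
    obtain ⟨u, v, huv⟩ := hcop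
    have := congrArg (Int.cast : ℤ → EisensteinInt) huv
    rw [Int.cast_add, Int.cast_mul, Int.cast_mul v, ← hsum, ← hprod, Int.cast_one] at this
    exact ⟨u + v * z', u, by rw [← this]; ring⟩
  obtain ⟨d, u, hu⟩ := exists_associated_pow_of_mul_eq_pow' hzz (c := (s : EisensteinInt)) (k := 3)
    (by rw [hprod, h, Int.cast_pow])
  obtain ⟨m, n, hmn⟩ := EisensteinInt.exists_cube_eq d
  have hcube : (⟨m + n, 2 * n⟩ : EisensteinInt) ^ 3 =
      ⟨m * (m ^ 2 - 9 * n ^ 2) + 3 * n * (m ^ 2 - n ^ 2), 2 * (3 * n * (m ^ 2 - n ^ 2))⟩ := by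
    ext <;> simp [pow_succ] <;> ring
  rw [hmn, hcube] at hu
  have hre := congrArg QuadraticAlgebra.re hu
  have him := congrArg QuadraticAlgebra.im hu
  rw [QuadraticAlgebra.re_mul] at hre
  rw [QuadraticAlgebra.im_mul] at him
  simp only [z] at hre him
  generalize hM : m * (m ^ 2 - 9 * n ^ 2) = M at *
  generalize hN : 3 * n * (m ^ 2 - n ^ 2) = N at *
  obtain ⟨k, hk⟩ := hodd
  obtain ⟨e, he, hcases⟩ := EisensteinInt.unit_cases u
  rcases hcases with h' | h' | h' <;> rw [h'] at hre him <;> simp only at hre him <;>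
    rcases he with rfl | rfl
  · exact ⟨m, n, by linarith, by linarith⟩
  · refine ⟨-m, -n, ?_, ?_⟩
    · linarith
    · linarith
  -- The units ±ω and ±(1 + ω) are excluded by parity: a + b is odd and the ω-coordinate 2b is even.
  all_goals omega

/-- Euler: the equation `α³ + β³ = 2 γ³` has only trivial solutions. -/
theorem eq_of_cube_add_cube_eq_two_mul_cube (k : ℕ) : ∀ {α β γ : ℤ}, γ.natAbs ≤ k →
    IsCoprime α β → Odd α → Odd β → α ^ 3 + β ^ 3 = 2 * γ ^ 3 → γ ≠ 0 → α = β := by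
  induction k with
  | zero => intro α β γ hk _ _ _ _ h0; omega
  | succ k ih =>
  intro α β γ hk hcop hα hβ heq hγ
  by_contra hne
  obtain ⟨i, hi⟩ := hα
  obtain ⟨j, hj⟩ := hβ
  -- With u, v the half sum and half difference, the equation becomes u(u² + 3v²) = γ³. The descent
  -- is on |γ|, bounded by k.
  obtain ⟨u, v, hu, hv⟩ : ∃ u v : ℤ, α = u + v ∧ β = u - v := ⟨i + j + 1, i - j, by omega, by omega⟩
  have hv0 : v ≠ 0 := by rintro rfl; omega
  have huv : u * (u ^ 2 + 3 * v ^ 2) = γ ^ 3 := by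
    rw [hu, hv] at heq; linarith
  have hu0 : u ≠ 0 := by
    rintro rfl
    rw [zero_mul] at huv
    exact hγ (pow_eq_zero_iff three_ne_zero |>.1 huv.symm)
  have hcuv : IsCoprime u v := by
    obtain ⟨x, y, hxy⟩ := hcop
    exact ⟨x + y, x - y, by rw [hu, hv] at hxy; linear_combination hxy⟩
  have hodd : Odd (u + v) := ⟨i, by omega⟩
  have hs2 : ∀ {s a b : ℤ}, a ≠ 0 → b ≠ 0 → a ^ 2 + 3 * b ^ 2 = s ^ 3 → 2 ≤ s := by
    intro s a b ha hb h
    by_contra! hlt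
    have h1 : 0 < a ^ 2 := by positivity
    have h2 : 0 < b ^ 2 := by positivity
    have h3 : s ^ 3 ≤ 1 ^ 3 := by
      rcases le_or_gt s 0 with hs | hs
      · have := Odd.pow_nonpos (n := 3) (by decide) hs
        linarith
      · rw [show s = 1 by omega]
    omega
  -- The factors u and u² + 3v² are coprime unless 3 ∣ u. In that case u = 9t and γ = 3δ, and t(v² +
  -- 27t²) = δ³ has coprime factors.
  by_cases h3 : (3 : ℤ) ∣ u
  · obtain ⟨w, rfl⟩ := h3
    have h3v : ¬ (3 : ℤ) ∣ v := fun h =>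
      Int.prime_three.not_isUnit (hcuv.isUnit_of_dvd' (dvd_mul_right 3 w) h)
    have h3γ : (3 : ℤ) ∣ γ := Int.prime_three.dvd_of_dvd_pow (n := 3)
      ⟨w * ((3 * w) ^ 2 + 3 * v ^ 2), by rw [← huv]; ring⟩
    obtain ⟨δ, rfl⟩ := h3γ
    have h1 : w * (3 * w ^ 2 + v ^ 2) = 3 * δ ^ 3 := by linarith
    have h3w : (3 : ℤ) ∣ w := by
      have : (3 : ℤ) ∣ w * v ^ 2 := ⟨δ ^ 3 - w ^ 3, by linear_combination h1⟩
      rcases Int.prime_three.dvd_or_dvd this with h | h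
      · exact h
      · exact absurd (Int.prime_three.dvd_of_dvd_pow h) h3v
    obtain ⟨t, rfl⟩ := h3w
    have h2 : t * (v ^ 2 + 3 * (3 * t) ^ 2) = δ ^ 3 := by linarith
    have hctv : IsCoprime t v := hcuv.of_mul_left_right.of_mul_left_right
    have hc3 : IsCoprime (3 * t) v := hcuv.of_mul_left_right
    have hc2 : IsCoprime t (v ^ 2 + 3 * (3 * t) ^ 2) := by
      have := (hctv.pow_right (n := 2)).add_mul_left_right (27 * t)
      rwa [show v ^ 2 + t * (27 * t) = v ^ 2 + 3 * (3 * t) ^ 2 by ring] at this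
    obtain ⟨⟨r, hr⟩, ⟨s, hs⟩⟩ := Int.eq_pow_of_mul_eq_pow_odd hc2 (by decide : Odd 3) h2
    have hodd' : Odd (v + 3 * t) := by
      obtain ⟨l, hl⟩ := hodd
      exact ⟨l - 3 * t, by omega⟩
    obtain ⟨m, n, hm, hn⟩ := exists_of_sq_add_three_mul_sq_eq_cube hc3.symm hodd' h3v hs
    have ht : n * ((m - n) * (m + n)) = r ^ 3 := by rw [← hr]; linarith
    have hmn : IsCoprime m n := by
      rw [hm, hn] at hc3
      exact (hc3.symm.of_mul_left_left).of_mul_right_left.of_mul_right_right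
    have hmn2 : Odd (m - n) := by
      rw [hm, hn] at hodd'
      rw [← Int.not_even_iff_odd] at hodd' ⊢
      intro he
      apply hodd'
      have : m * (m ^ 2 - 9 * n ^ 2) + 3 * n * (m ^ 2 - n ^ 2) =
          (m - n) * (m ^ 2 + 4 * m * n - 5 * n ^ 2) - 2 * (4 * n ^ 3) := by ring
      rw [this]
      exact (he.mul_right _).sub (even_two_mul _)
    have c1 : IsCoprime (m - n) (m + n) := by
      have h2 : IsCoprime (m - n) 2 := (Int.isCoprime_two_right).2 hmn2
      have hn' : IsCoprime (m - n) n := by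
        have := hmn.symm.add_mul_left_right (-1)
        rw [show m + n * (-1) = m - n by ring] at this
        exact this.symm
      have := (h2.mul_right hn').add_mul_left_right 1
      rwa [show 2 * n + (m - n) * 1 = m + n by ring] at this
    have c2 : IsCoprime n ((m - n) * (m + n)) := by
      have h1 := hmn.symm.add_mul_left_right (-1)
      have h2 := hmn.symm.add_mul_left_right 1
      rw [show m + n * (-1) = m - n by ring] at h1
      rw [show m + n * 1 = m + n by ring] at h2
      exact h1.mul_right h2
    obtain ⟨⟨g, hg⟩, ⟨q, hq⟩⟩ := Int.eq_pow_of_mul_eq_pow_odd c2 (by decide : Odd 3) ht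
    obtain ⟨⟨x, hx⟩, ⟨y, hy⟩⟩ := Int.eq_pow_of_mul_eq_pow_odd c1 (by decide : Odd 3) hq
    have ht0 : t ≠ 0 := by rintro rfl; simp at hu0
    have hr0 : r ≠ 0 := by rintro rfl; exact ht0 (by rw [hr]; ring)
    have hn0 : n ≠ 0 := by
      rintro rfl
      rw [zero_mul] at ht
      exact hr0 (pow_eq_zero_iff three_ne_zero |>.1 ht.symm)
    have hm0 : m ≠ 0 := by rintro rfl; rw [zero_mul] at hm; exact hv0 hm
    have hg0 : g ≠ 0 := by rintro rfl; exact hn0 (by rw [hg]; ring)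
    have hgr : g.natAbs ≤ r.natAbs := by
      have : g ∣ r := by
        rw [← Int.pow_dvd_pow_iff three_ne_zero, ← hg]
        exact ⟨_, ht.symm⟩
      exact Nat.le_of_dvd (Int.natAbs_pos.2 hr0) (Int.natAbs_dvd_natAbs.2 this)
    have hδ : δ.natAbs = r.natAbs * s.natAbs := by
      rw [← Int.natAbs_mul]
      congr 1
      have : δ ^ 3 = (r * s) ^ 3 := by rw [mul_pow r s, ← hr, ← hs, h2]
      exact (Odd.strictMono_pow (by decide : Odd 3)).injective this
    have hs' := hs2 hv0 (mul_ne_zero three_ne_zero ht0) hs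
    have hxodd : Odd x := by
      rw [hx] at hmn2
      exact (Int.odd_pow' three_ne_zero).1 hmn2
    have hyodd : Odd y := by
      have : Odd (m + n) := by
        rw [show m + n = (m - n) + 2 * n by ring]; exact hmn2.add_even (even_two_mul n)
      rw [hy] at this
      exact (Int.odd_pow' three_ne_zero).1 this
    have hxy : IsCoprime y (-x) := by
      rw [hx, hy] at c1
      exact ((IsCoprime.pow_iff three_pos three_pos).1 c1).symm.neg_right
    -- The cubes n, m - n, m + n satisfy (m + n) - (m - n) = 2n. Here |g| ≤ |r| ≤ |δ| < |γ|, and the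
    -- conclusion y = -x would give m = 0.
    have := ih (α := y) (β := -x) (γ := g) (by
        rw [Int.natAbs_mul, hδ] at hk
        have h1 : r.natAbs * 1 ≤ r.natAbs * s.natAbs := Nat.mul_le_mul_left _ (by omega)
        have : 0 < r.natAbs := Int.natAbs_pos.2 hr0
        have e3 : (3 : ℤ).natAbs = 3 := rfl
        rw [e3] at hk
        omega) hxy hyodd hxodd.neg
      (by rw [← hg, Odd.neg_pow (by decide), ← hx, ← hy]; ring) hg0
    apply hm0
    have : y ^ 3 = -x ^ 3 := by rw [this]; ring
    rw [← hx, ← hy] at this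
    linarith
  · have hc3 : IsCoprime u 3 := ((Int.prime_three.coprime_iff_not_dvd).2 h3).symm
    have hc2 : IsCoprime u (u ^ 2 + 3 * v ^ 2) := by
      have := (hc3.mul_right (hcuv.pow_right (n := 2))).add_mul_left_right u
      rwa [show 3 * v ^ 2 + u * u = u ^ 2 + 3 * v ^ 2 by ring] at this
    obtain ⟨⟨r, hr⟩, ⟨s, hs⟩⟩ := Int.eq_pow_of_mul_eq_pow_odd hc2 (by decide : Odd 3) huv
    obtain ⟨m, n, hm, hn⟩ := exists_of_sq_add_three_mul_sq_eq_cube hcuv hodd h3 hs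
    have ht : m * ((m - 3 * n) * (m + 3 * n)) = r ^ 3 := by rw [← hr]; linear_combination -hm
    have hmn : IsCoprime m n := by
      rw [hm, hn] at hcuv
      exact (hcuv.of_mul_left_left).of_mul_right_left.of_mul_right_right
    have h3m : IsCoprime m 3 := by
      rw [hm] at hc3
      exact hc3.of_mul_left_left
    have hm3n := h3m.mul_right hmn
    have hmn2 : Odd (m - 3 * n) := by
      rw [hm, hn] at hodd
      rw [← Int.not_even_iff_odd] at hodd ⊢
      intro he
      apply hodd
      have : m * (m ^ 2 - 9 * n ^ 2) + 3 * n * (m ^ 2 - n ^ 2) =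
          (m - 3 * n) * (m ^ 2 + 6 * m * n + 9 * n ^ 2) + 2 * (12 * n ^ 3) := by ring
      rw [this]
      exact (he.mul_right _).add (even_two_mul _)
    have c1 : IsCoprime (m - 3 * n) (m + 3 * n) := by
      have h2 : IsCoprime (m - 3 * n) 2 := (Int.isCoprime_two_right).2 hmn2
      have hn' : IsCoprime (m - 3 * n) (3 * n) := by
        have := hm3n.symm.add_mul_left_right (-1)
        rw [show m + 3 * n * (-1) = m - 3 * n by ring] at this
        exact this.symm
      have := (h2.mul_right hn').add_mul_left_right 1
      rwa [show 2 * (3 * n) + (m - 3 * n) * 1 = m + 3 * n by ring] at this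
    have c2 : IsCoprime m ((m - 3 * n) * (m + 3 * n)) := by
      have h1 := (hm3n.neg_right).add_mul_left_right 1
      have h2 := hm3n.add_mul_left_right 1
      rw [show -(3 * n) + m * 1 = m - 3 * n by ring] at h1
      rw [show 3 * n + m * 1 = m + 3 * n by ring] at h2
      exact h1.mul_right h2
    obtain ⟨⟨g, hg⟩, ⟨q, hq⟩⟩ := Int.eq_pow_of_mul_eq_pow_odd c2 (by decide : Odd 3) ht
    obtain ⟨⟨x, hx⟩, ⟨y, hy⟩⟩ := Int.eq_pow_of_mul_eq_pow_odd c1 (by decide : Odd 3) hq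
    have hr0 : r ≠ 0 := by rintro rfl; exact hu0 (by rw [hr]; ring)
    have hn0 : n ≠ 0 := by rintro rfl; exact hv0 (by rw [hn]; ring)
    have hg0 : g ≠ 0 := by
      rintro rfl
      rw [hg] at hm
      exact hu0 (by rw [hm]; ring)
    have hgr : g.natAbs ≤ r.natAbs := by
      have : g ∣ r := by
        rw [← Int.pow_dvd_pow_iff three_ne_zero, ← hg]
        exact ⟨_, ht.symm⟩
      exact Nat.le_of_dvd (Int.natAbs_pos.2 hr0) (Int.natAbs_dvd_natAbs.2 this)
    have hδ : γ.natAbs = r.natAbs * s.natAbs := by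
      rw [← Int.natAbs_mul]
      congr 1
      have : γ ^ 3 = (r * s) ^ 3 := by rw [mul_pow r s, ← hr, ← hs, huv]
      exact (Odd.strictMono_pow (by decide : Odd 3)).injective this
    have hs' := hs2 hu0 hv0 hs
    have hxodd : Odd x := by
      rw [hx] at hmn2
      exact (Int.odd_pow' three_ne_zero).1 hmn2
    have hyodd : Odd y := by
      have : Odd (m + 3 * n) := by
        rw [show m + 3 * n = (m - 3 * n) + 2 * (3 * n) by ring]
        exact hmn2.add_even (even_two_mul _)
      rw [hy] at this
      exact (Int.odd_pow' three_ne_zero).1 this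
    have hxy : IsCoprime x y := by
      rw [hx, hy] at c1
      exact (IsCoprime.pow_iff three_pos three_pos).1 c1
    -- Now (m - 3n) + (m + 3n) = 2m. The descent is strict because s ≥ 2, and x = y would give n =
    -- 0.
    have := ih (α := x) (β := y) (γ := g) (by
        rw [hδ] at hk
        have h1 : r.natAbs * 2 ≤ r.natAbs * s.natAbs := Nat.mul_le_mul_left _ (by omega)
        have : 0 < r.natAbs := Int.natAbs_pos.2 hr0
        omega) hxy hxodd hyodd
      (by rw [← hg, ← hx, ← hy]; ring) hg0
    apply hn0
    have : x ^ 3 = y ^ 3 := by rw [this]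
    rw [← hx, ← hy] at this
    linarith

/-- A, B, D are pairwise coprime with product a cube, so each is a cube and A + B = -2D is Euler's
equation. -/
theorem eq_of_mul_eq_two_mul_cube {A B D S : ℤ} (hAB : IsCoprime A B) (hsum : A + B + 2 * D = 0)
    (hA : Odd A) (hD : D ≠ 0) (h : A * B * D = S ^ 3) : A = B := by
  have hB : Odd B := by
    obtain ⟨k, rfl⟩ := hA
    exact ⟨-k - D - 1, by omega⟩
  have hcD : IsCoprime (A * B) D := by
    refine IsCoprime.mul_left ?_ ?_
    · have := hAB.neg_right.add_mul_left_right (-1)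
      rw [show -B + A * (-1) = 2 * D by linarith] at this
      exact this.of_mul_right_right
    · have := hAB.symm.neg_right.add_mul_left_right (-1)
      rw [show -A + B * (-1) = 2 * D by linarith] at this
      exact this.of_mul_right_right
  obtain ⟨⟨q, hq⟩, ⟨d, hd⟩⟩ := Int.eq_pow_of_mul_eq_pow_odd hcD (by decide : Odd 3) h
  obtain ⟨⟨α, hα⟩, ⟨β, hβ⟩⟩ := Int.eq_pow_of_mul_eq_pow_odd hAB (by decide : Odd 3) hq
  have hd0 : d ≠ 0 := by rintro rfl; exact hD (by rw [hd]; ring)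
  rw [hα, hβ] at hAB ⊢
  rw [hα] at hA
  rw [hβ] at hB
  rw [eq_of_cube_add_cube_eq_two_mul_cube _ le_rfl ((IsCoprime.pow_iff three_pos three_pos).1 hAB)
    ((Int.odd_pow' three_ne_zero).1 hA) ((Int.odd_pow' three_ne_zero).1 hB) (γ := -d)
    (by rw [← hα, ← hβ, Odd.neg_pow (by decide), ← hd]; linarith) (neg_ne_zero.2 hd0)]

/-- T is even, so ABC = 2S³ and one of A, B, C is even. Writing it as 2D leaves a product equal to
S³. -/
theorem eq_of_four_mul_eq_cube_int {A B C T : ℤ} (hAB : IsCoprime A B) (hsum : A + B + C = 0)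
    (h0 : A * B * C ≠ 0) (h : 4 * (A * B * C) = T ^ 3) : A = B ∨ B = C ∨ C = A := by
  have hT : (2 : ℤ) ∣ T := Int.prime_two.dvd_of_dvd_pow (n := 3)
    ⟨2 * (A * B * C), by rw [← h]; ring⟩
  obtain ⟨S, rfl⟩ := hT
  have hS : A * B * C = 2 * S ^ 3 := by linarith
  have hBC : IsCoprime B C := by
    have := hAB.symm.neg_right.add_mul_left_right (-1)
    rwa [show -A + B * (-1) = C by linarith] at this
  have hCA : IsCoprime C A := by
    have := hAB.neg_right.add_mul_left_right (-1)
    rw [show -B + A * (-1) = C by linarith] at this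
    exact this.symm
  have hodd : ∀ {X Y : ℤ}, IsCoprime X (2 * Y) → Odd X := fun hc =>
    Int.isCoprime_two_right.1 hc.of_mul_right_left
  have heven : (2 : ℤ) ∣ A * B * C := ⟨_, hS⟩
  rcases Int.prime_two.dvd_or_dvd heven with hd | ⟨D, rfl⟩
  · rcases Int.prime_two.dvd_or_dvd hd with ⟨D, rfl⟩ | ⟨D, rfl⟩
    · exact Or.inr (Or.inl (eq_of_mul_eq_two_mul_cube (D := D) (S := S) hBC (by linarith)
        (hodd hAB.symm) (by rintro rfl; simp at h0) (by linarith)))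
    · exact Or.inr (Or.inr (eq_of_mul_eq_two_mul_cube (D := D) (S := S) hCA (by linarith)
        (hodd hBC.symm) (by rintro rfl; simp at h0) (by linarith)))
  · exact Or.inl (eq_of_mul_eq_two_mul_cube (D := D) (S := S) hAB (by linarith)
      (hodd hCA.symm) (by rintro rfl; simp at h0) (by linarith))

/-- By homogeneity the triple scales to coprime integers, the numerator and denominator of A/B; the
scaled t has an integral cube, so it is an integer. -/
theorem eq_of_four_mul_cube {A B C : ℚ} (hsum : A + B + C = 0) (h0 : A * B * C ≠ 0) {t : ℚ}
    (ht : 4 * (A * B * C) = t ^ 3) : A = B ∨ B = C ∨ C = A := by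
  obtain ⟨⟨-, hB⟩, -⟩ : (A ≠ 0 ∧ B ≠ 0) ∧ C ≠ 0 := by simpa only [mul_ne_zero_iff] using h0
  set q := A / B with hq
  set l := B / q.den with hl
  have hden : (q.den : ℚ) ≠ 0 := by exact_mod_cast q.den_ne_zero
  have hl0 : l ≠ 0 := div_ne_zero hB hden
  have hBl : B = l * ((q.den : ℤ) : ℚ) := by
    rw [hl]; push_cast; rw [div_mul_cancel₀ _ hden]
  have hAl : A = l * ((q.num : ℤ) : ℚ) := by
    rw [hl, div_mul_eq_mul_div, mul_div_assoc, Rat.num_div_den, hq, mul_div_cancel₀ _ hB]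
  have hCl : C = l * ((-(q.num + q.den) : ℤ) : ℚ) := by
    push_cast
    push_cast at hBl
    linear_combination hsum - hAl - hBl
  have hcop : IsCoprime q.num (q.den : ℤ) := Rat.isCoprime_num_den q
  generalize q.num = a at *
  generalize (q.den : ℤ) = b at *
  rw [hAl, hBl, hCl] at ht h0
  have hcube : (t / l) ^ 3 = ((4 * (a * b * -(a + b)) : ℤ) : ℚ) := by
    rw [div_pow, ← ht, div_eq_iff (pow_ne_zero _ hl0)]
    push_cast
    ring
  obtain ⟨T, hT⟩ := IsIntegrallyClosed.exists_algebraMap_eq_of_isIntegral_pow (R := ℤ)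
    three_pos (x := t / l) (by rw [hcube]; exact isIntegral_algebraMap)
  have hT' : 4 * (a * b * -(a + b)) = T ^ 3 := by
    rw [← hT, eq_intCast, ← Int.cast_pow] at hcube
    exact Int.cast_injective hcube.symm
  have h0' : a * b * -(a + b) ≠ 0 := by
    intro h
    apply h0
    have : ((a * b * -(a + b) : ℤ) : ℚ) = 0 := by rw [h, Int.cast_zero]
    push_cast at this ⊢
    linear_combination l ^ 3 * this
  rw [hAl, hBl, hCl]
  rcases eq_of_four_mul_eq_cube_int hcop (by ring) h0' hT' with h | h | h
  · exact Or.inl (by rw [h])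
  · exact Or.inr (Or.inl (by rw [← h]))
  · exact Or.inr (Or.inr (by rw [h]))

/-! ### The Galois action on 3-torsion -/

instance isAlgebraic_rat_algebraicClosure : Algebra.IsAlgebraic ℚ (AlgebraicClosure ℚ) :=
  AlgebraicClosure.isAlgebraic ℚ

instance isGalois_rat_algebraicClosure : IsGalois ℚ (AlgebraicClosure ℚ) :=
  have : IsAlgClosure ℚ (AlgebraicClosure ℚ) := ⟨inferInstance, inferInstance⟩
  IsAlgClosure.isGalois ℚ (AlgebraicClosure ℚ)

theorem mem_adjoin_sqrt_of_fixed {d : ℤ} {x : AlgebraicClosure ℚ}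
    (hx : ∀ σ ∈ GQSqrt d, σ x = x) :
    x ∈ IntermediateField.adjoin ℚ {t : AlgebraicClosure ℚ | t ^ 2 = (d : AlgebraicClosure ℚ)} := by
  rw [← InfiniteGalois.fixedField_fixingSubgroup (IntermediateField.adjoin ℚ _)]
  rw [IntermediateField.mem_fixedField_iff]
  exact hx

/-- A cube root of a rational number that is moved by `g ∈ Gal(ℚ̄/ℚ(√-3))` is moved by `g ^ m`
whenever `3 ∤ m`. -/
theorem pow_apply_ne_of_cube_eq {g : GQ} (hg : g ∈ GQSqrt (-3)) {c : AlgebraicClosure ℚ}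
    {q : ℚ} (hc : c ^ 3 = algebraMap ℚ _ q) (hgc : g c ≠ c) {m : ℕ} (hm : ¬ 3 ∣ m) :
    (g ^ m) c ≠ c := by
  have hc0 : c ≠ 0 := by rintro rfl; exact hgc (map_zero g)
  set z := g c / c with hz
  have hgz : g c = z * c := by rw [hz, div_mul_cancel₀ _ hc0]
  have hz3 : z ^ 3 = 1 := by
    rw [hz, div_pow, ← map_pow, hc, AlgEquiv.commutes, div_self]
    rw [← hc]
    exact pow_ne_zero _ hc0
  have hz1 : z ≠ 1 := fun h => hgc (by rw [hgz, h, one_mul])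
  -- For a primitive cube root of unity z, 2z + 1 is a square root of -3, so g fixes z and
  -- multiplies c by zⁿ after n steps.
  have hfix : g z = z := by
    have hroot : z ^ 2 + z + 1 = 0 := by
      apply mul_left_cancel₀ (sub_ne_zero.2 hz1)
      linear_combination hz3
    have h1 : g (2 * z + 1) = 2 * z + 1 := by
      refine (mem_fixingSubgroup_iff _).1 hg (2 * z + 1) (IntermediateField.subset_adjoin ℚ _ ?_)
      change (2 * z + 1) ^ 2 = ((-3 : ℤ) : AlgebraicClosure ℚ)
      push_cast
      linear_combination 4 * hroot
    rw [map_add, map_mul, map_ofNat, map_one] at h1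
    have : (2 : AlgebraicClosure ℚ) * g z = 2 * z := by linear_combination h1
    exact mul_left_cancel₀ two_ne_zero this
  have hpow : ∀ n : ℕ, (g ^ n) c = z ^ n * c := by
    intro n
    induction n with
    | zero => simp
    | succ n ih => rw [pow_succ', AlgEquiv.mul_apply, ih, map_mul, map_pow, hfix, hgz]; ring
  rw [hpow]
  intro h
  have hzm : z ^ m = 1 := mul_right_cancel₀ hc0 (by rw [h, one_mul])
  apply hm
  have : orderOf z = 3 := by
    have : Fact (Nat.Prime 3) := ⟨Nat.prime_three⟩
    exact orderOf_eq_prime hz3 hz1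
  rw [← this]
  exact orderOf_dvd_of_pow_eq_one hzm

theorem modRep_some (E : WeierstrassCurve ℚ) (l : ℕ) (σ : GQ) (x y : AlgebraicClosure ℚ)
    (h : (E.baseChange (AlgebraicClosure ℚ)).toAffine.Nonsingular x y)
    (hP : WeierstrassCurve.Affine.Point.some x y h ∈
      AddSubgroup.torsionBy (E.baseChange (AlgebraicClosure ℚ)).toAffine.Point (l : ℤ)) :
    ∃ h' : (E.baseChange (AlgebraicClosure ℚ)).toAffine.Nonsingular (σ x) (σ y),
      (modRep E l σ ⟨_, hP⟩).1 = WeierstrassCurve.Affine.Point.some (σ x) (σ y) h' :=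
  ⟨_, rfl⟩

theorem isStronglyIrreducible_three_modRep (E : WeierstrassCurve ℚ)
    (h1 : E.a₁ = 0) (h3 : E.a₃ = 0) (h6 : E.a₆ = 0) (h4 : E.a₄ ≠ 0)
    (hd : E.a₂ ^ 2 - 4 * E.a₄ ≠ 0)
    (hcube : ∀ t : ℚ, t ^ 3 ≠ 16 * E.a₄ ^ 2 * (E.a₂ ^ 2 - 4 * E.a₄))
    (hroot : ∀ x ∈ IntermediateField.adjoin ℚ {t : AlgebraicClosure ℚ |
      t ^ 2 = ((-3 : ℤ) : AlgebraicClosure ℚ)},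
      threeDivision (algebraMap ℚ (AlgebraicClosure ℚ) E.a₂) (algebraMap ℚ _ E.a₄) x ≠ 0) :
    IsStronglyIrreducible 3 (modRep E 3) := by
  classical
  have hstar : ((-1) ^ ((3 - 1) / 2) * ((3 : ℕ) : ℤ)) = -3 := by norm_num
  rw [IsStronglyIrreducible, hstar]
  set W := E.baseChange (AlgebraicClosure ℚ) with hW
  have w1 : W.a₁ = 0 := by simp [hW, h1]
  have w3 : W.a₃ = 0 := by simp [hW, h3]
  have w6 : W.a₆ = 0 := by simp [hW, h6]
  have w2 : W.a₂ = algebraMap ℚ _ E.a₂ := rfl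
  have w4 : W.a₄ = algebraMap ℚ _ E.a₄ := rfl
  have w40 : W.a₄ ≠ 0 := by rw [w4]; simpa using h4
  have wΔ : algebraMap ℚ (AlgebraicClosure ℚ) (E.a₂ ^ 2 - 4 * E.a₄) = W.a₂ ^ 2 - 4 * W.a₄ := by
    rw [w2, w4, map_sub, map_mul, map_pow, map_ofNat]
  have wd : W.a₂ ^ 2 - 4 * W.a₄ ≠ 0 := by
    rw [← wΔ]; exact (map_ne_zero _).2 hd
  have w22 : (2 : AlgebraicClosure ℚ) ≠ 0 := two_ne_zero
  have hmem : ∀ P : W.toAffine.Point, P ∈ AddSubgroup.torsionBy W.toAffine.Point ((3 : ℕ) : ℤ) ↔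
      3 • P = 0 := fun P => by
    rw [AddSubgroup.torsionBy.nsmul_iff]
  obtain ⟨hfin, hcard⟩ := finite_and_card_le_of_three_nsmul_eq_zero W w1 w3 w6 w40 wd _ hmem
  obtain ⟨x, hx⟩ := exists_threeDivision_eq_prod W.a₂ W.a₄
  have hres := resolvent_cube_eq hx
  set c := 2 * W.a₄ - 3 * (x 0 * x 1 + x 2 * x 3) with hc
  have hcq : c ^ 3 = algebraMap ℚ _ (16 * E.a₄ ^ 2 * (E.a₂ ^ 2 - 4 * E.a₄)) := by
    rw [hres, map_mul, wΔ, map_mul, map_pow, map_ofNat, w4]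
  obtain ⟨g, hg, hgc⟩ : ∃ g ∈ GQSqrt (-3), g c ≠ c := by
    by_contra! hfix
    obtain ⟨t, ht⟩ := exists_cube_root_rat_of_mem_adjoin_sqrt_neg_three
      (mem_adjoin_sqrt_of_fixed hfix) hcq
    exact hcube t ht
  refine isAbsolutelyIrreducible_of_card_le (p := 3) hcard _ ⟨g, hg⟩ ?_ ?_
  · intro m hm htriv
    refine pow_apply_ne_of_cube_eq hg hcq hgc hm ?_
    -- Trivial action on 3-torsion fixes all four abscissas, hence c, which is a polynomial in them
    -- and a₄.
    have hxi : ∀ i, (g ^ m) (x i) = x i := by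
      intro i
      obtain ⟨y, hy, hP⟩ := exists_torsion_point_of_threeDivision w22 W w1 w3 w6 w40 wd
        (x := x i) (by rw [hx, Finset.prod_eq_zero (Finset.mem_univ i) (sub_self _), mul_zero])
      obtain ⟨h', hact⟩ := modRep_some E 3 (g ^ m) (x i) y hy ((hmem _).2 hP)
      have := LinearMap.congr_fun htriv ⟨_, (hmem _).2 hP⟩
      have := (congrArg Subtype.val this).symm.trans hact
      exact ((WeierstrassCurve.Affine.Point.some.injEq _ _ _ _ _ _).mp this).1.symm
    have h2 : (g ^ m) W.a₄ = W.a₄ := by rw [w4, AlgEquiv.commutes]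
    simp only [hc, map_sub, map_mul, map_add, hxi, h2, map_ofNat]
  · rintro ⟨_ | ⟨s, t, hst⟩, hP⟩ hv
    · exact absurd rfl hv
    by_contra! hs
    have hr := (three_nsmul_some_eq_zero_iff w22 W w1 w3 w6 s t hst).1 ((hmem _).1 hP)
    refine hroot s (mem_adjoin_sqrt_of_fixed fun σ hσ => ?_) hr
    obtain ⟨k, hk⟩ := hs ⟨σ, hσ⟩
    obtain ⟨h', hact⟩ := modRep_some E 3 σ s t hst hP
    have hk' := (congrArg Subtype.val hk).symm.trans hact
    -- The nonzero scalars of 𝔽₃ are ±1, and ±P share their abscissa; so a stable line has an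
    -- abscissa fixed by G_{ℚ(√-3)}.
    have hcases : k = 0 ∨ k = 1 ∨ k = -1 :=
      (by decide : ∀ k : ZMod 3, k = 0 ∨ k = 1 ∨ k = -1) k
    rcases hcases with rfl | rfl | rfl
    · rw [zero_smul] at hk'
      exact absurd hk'.symm (WeierstrassCurve.Affine.Point.some_ne_zero _)
    · rw [one_smul] at hk'
      exact ((WeierstrassCurve.Affine.Point.some.injEq _ _ _ _ _ _).mp hk').1.symm
    · rw [neg_smul, one_smul] at hk'
      exact ((WeierstrassCurve.Affine.Point.some.injEq _ _ _ _ _ _).mp hk').1.symm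

/-! ### Ninth powers mod p and the main theorem -/

theorem isUnitPow_of_mul_pow_eq {p n : ℕ} [Fact p.Prime] {a b x y : ZMod p} (hb : b ≠ 0)
    (hx : x ≠ 0) (hy : y ≠ 0) (h : a * x ^ n = b * y ^ n) : IsUnitPow n (a / b) := by
  refine ⟨Units.mk0 (y / x) (div_ne_zero hy hx), ?_⟩
  rw [Units.val_mk0, div_pow, div_eq_div_iff hb (pow_ne_zero _ hx), h, mul_comm]

/-- If `a x^n + b y^n + c z^n = 0` with `n` odd and `(x, y, z) ≠ 0`, and `b / c` is not an `n`-th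
power, then `x ≠ 0`. -/
theorem ne_zero_of_not_isUnitPow {p n : ℕ} [Fact p.Prime] (hn : Odd n) {a b c x y z : ZMod p}
    (hb : b ≠ 0) (hc : c ≠ 0) (h : a * x ^ n + b * y ^ n + c * z ^ n = 0)
    (hxyz : ¬ (x = 0 ∧ y = 0 ∧ z = 0))
    (hpow : ¬ IsUnitPow n (b / c)) : x ≠ 0 := by
  rintro rfl
  have hn0 : n ≠ 0 := hn.pos.ne'
  rw [zero_pow hn0, mul_zero, zero_add] at h
  have hz : z ≠ 0 := by
    rintro rfl
    rw [zero_pow hn0, mul_zero, add_zero] at h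
    exact hxyz ⟨rfl, by simpa [hb, hn0] using h, rfl⟩
  have hy : y ≠ 0 := by
    rintro rfl
    rw [zero_pow hn0, mul_zero, zero_add] at h
    exact hz (by simpa [hc, hn0] using h)
  exact hpow (isUnitPow_of_mul_pow_eq hc hy (neg_ne_zero.2 hz)
    (by rw [hn.neg_pow]; linear_combination h))

theorem proposition4p5 (a b c : ℤ) (p : ℕ) [Fact p.Prime]
    (hpabc : ¬ (p : ℤ) ∣ a * b * c)
    (hp9 : p ≡ 1 [MOD 9])
    (hpow : ¬ (IsUnitPow 9 ((a : ZMod p) / (b : ZMod p)) ∨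
      IsUnitPow 9 ((b : ZMod p) / (c : ZMod p)) ∨
      IsUnitPow 9 ((c : ZMod p) / (a : ZMod p))))
    (htrace : ∀ P ∈ fermatPairs a b c 9 p,
      (3 : ℤ) ∣ traceFrob (freyCurve ((a : ZMod p) * (P.1 : ZMod p) ^ 9)
        ((b : ZMod p) * (P.2 : ZMod p) ^ 9)))
    (x y z : ℤ) (hxyz : x * y * z ≠ 0)
    (hprim : Int.gcd (Int.gcd x y : ℤ) z = 1)
    (hsol : a * x ^ 9 + b * y ^ 9 + c * z ^ 9 = 0) :
    IsStronglyIrreducible 3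
      (modRep (freyCurve ((a : ℚ) * (x : ℚ) ^ 9) ((b : ℚ) * (y : ℚ) ^ 9)) 3) := by
  have hprime : p.Prime := Fact.out
  have hp91 : p % 9 = 1 := hp9
  have hp2 : p ≠ 2 := by rintro rfl; omega
  rw [not_or, not_or] at hpow
  obtain ⟨hab, hbc, hca⟩ := hpow
  have habc : (a : ZMod p) * b * c ≠ 0 := by
    rw [← ZMod.intCast_zmod_eq_zero_iff_dvd] at hpabc
    push_cast at hpabc
    exact hpabc
  obtain ⟨⟨ha, hb⟩, hc⟩ : ((a : ZMod p) ≠ 0 ∧ (b : ZMod p) ≠ 0) ∧ (c : ZMod p) ≠ 0 := by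
    simpa only [mul_ne_zero_iff] using habc
  have hsolp : (a : ZMod p) * x ^ 9 + b * y ^ 9 + c * z ^ 9 = 0 := by
    have := congrArg (Int.cast : ℤ → ZMod p) hsol
    push_cast at this
    exact this
  have hnot : ¬ ((x : ZMod p) = 0 ∧ (y : ZMod p) = 0 ∧ (z : ZMod p) = 0) := by
    simp only [ZMod.intCast_zmod_eq_zero_iff_dvd]
    rintro ⟨hx, hy, hz⟩
    have : (p : ℤ) ∣ Int.gcd (Int.gcd x y : ℤ) z := Int.dvd_coe_gcd (Int.dvd_coe_gcd hx hy) hz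
    rw [hprim] at this
    exact hprime.one_lt.ne' (by exact_mod_cast Int.eq_one_of_dvd_one (by positivity) this)
  have h9 : Odd 9 := by decide
  have hx : (x : ZMod p) ≠ 0 := ne_zero_of_not_isUnitPow h9 hb hc hsolp hnot hbc
  have hy : (y : ZMod p) ≠ 0 := ne_zero_of_not_isUnitPow (a := (b : ZMod p)) h9 hc ha
    (by linear_combination hsolp) (fun h => hnot ⟨h.2.2, h.1, h.2.1⟩) hca
  have hz : (z : ZMod p) ≠ 0 := ne_zero_of_not_isUnitPow (a := (c : ZMod p)) h9 ha hb
    (by linear_combination hsolp) (fun h => hnot ⟨h.2.1, h.2.2, h.1⟩) hab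
  -- As x, y, z are units mod p, the reduction of the Frey curve is one of the curves in the trace
  -- hypothesis.
  have hfermat := htrace (Units.mk0 _ hx, Units.mk0 _ hy) ⟨Units.mk0 _ hz, hsolp⟩
  simp only [Units.val_mk0] at hfermat
  have hinj : ∀ {u v : ℤ}, (u : ℚ) = v → (u : ZMod p) = v := fun h => by
    rw [Int.cast_injective h]
  have hx0 : (x : ℤ) ≠ 0 := by rintro rfl; simp at hx
  have hy0 : (y : ℤ) ≠ 0 := by rintro rfl; simp at hy
  have hz0 : (z : ℤ) ≠ 0 := by rintro rfl; simp at hz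
  have ha0 : (a : ℤ) ≠ 0 := by rintro rfl; simp at ha
  have hb0 : (b : ℤ) ≠ 0 := by rintro rfl; simp at hb
  have hc0 : (c : ℤ) ≠ 0 := by rintro rfl; simp at hc
  have hsolQ : (a : ℚ) * x ^ 9 + b * y ^ 9 + c * z ^ 9 = 0 := by exact_mod_cast hsol
  have hA : (a : ℚ) * x ^ 9 ≠ 0 := by positivity
  have hB : (b : ℚ) * y ^ 9 ≠ 0 := by positivity
  have hC : (c : ℚ) * z ^ 9 ≠ 0 := by positivity
  have hdisc : ∀ {F : Type} [Field F] (A B C : F), A + B + C = 0 →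
      (B - A) ^ 2 - 4 * -(A * B) = C ^ 2 := fun A B C h => by
    linear_combination (A + B - C) * h
  apply isStronglyIrreducible_three_modRep
  · rfl
  · rfl
  · rfl
  · exact neg_ne_zero.2 (mul_ne_zero hA hB)
  · change ((b : ℚ) * y ^ 9 - a * x ^ 9) ^ 2 - 4 * -(a * x ^ 9 * (b * y ^ 9)) ≠ 0
    rw [hdisc _ _ _ hsolQ]
    exact pow_ne_zero _ hC
  · intro t ht
    change t ^ 3 = 16 * (-(a * x ^ 9 * (b * y ^ 9))) ^ 2 *
      (((b : ℚ) * y ^ 9 - a * x ^ 9) ^ 2 - 4 * -(a * x ^ 9 * (b * y ^ 9))) at ht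
    rw [hdisc _ _ _ hsolQ] at ht
    have h0 : (a : ℚ) * x ^ 9 * (b * y ^ 9) * (c * z ^ 9) ≠ 0 := mul_ne_zero (mul_ne_zero hA hB) hC
    have ht' : t ^ 3 = (4 * ((a : ℚ) * x ^ 9 * (b * y ^ 9) * (c * z ^ 9))) ^ 2 := by
      rw [ht]; ring
    have ht0 : t ≠ 0 := by
      rintro rfl
      rw [zero_pow three_ne_zero] at ht'
      exact h0 (by simpa using ht'.symm)
    -- From t³ = M² with M = 4ABC it follows that M = (M/t)³.
    have hcube : 4 * ((a : ℚ) * x ^ 9 * (b * y ^ 9) * (c * z ^ 9)) =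
        (4 * ((a : ℚ) * x ^ 9 * (b * y ^ 9) * (c * z ^ 9)) / t) ^ 3 := by
      rw [div_pow, ht', eq_div_iff (by positivity)]
      ring
    -- The equality ax⁹ = by⁹ makes a/b = (y/x)⁹ mod p; the other two cases are cyclic.
    rcases eq_of_four_mul_cube hsolQ h0 hcube with h | h | h
    · exact hab (isUnitPow_of_mul_pow_eq hb hx hy (by exact_mod_cast hinj (by exact_mod_cast h)))
    · exact hbc (isUnitPow_of_mul_pow_eq hc hy hz (by exact_mod_cast hinj (by exact_mod_cast h)))
    · exact hca (isUnitPow_of_mul_pow_eq ha hz hx (by exact_mod_cast hinj (by exact_mod_cast h)))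
  · intro r hr
    have := threeDivision_ne_zero_of_mem_adjoin_sqrt (p := p) (by omega) hp2
      (b * y ^ 9 - a * x ^ 9) (-(a * x ^ 9 * (b * y ^ 9))) (fun s => ?_) hr
    · have e₂ : algebraMap ℚ (AlgebraicClosure ℚ)
          (freyCurve ((a : ℚ) * x ^ 9) ((b : ℚ) * y ^ 9)).a₂ =
          ((b * y ^ 9 - a * x ^ 9 : ℤ) : AlgebraicClosure ℚ) := by
        rw [← map_intCast (algebraMap ℚ (AlgebraicClosure ℚ))]
        simp only [freyCurve]
        push_cast
        rfl
      have e₄ : algebraMap ℚ (AlgebraicClosure ℚ)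
          (freyCurve ((a : ℚ) * x ^ 9) ((b : ℚ) * y ^ 9)).a₄ =
          ((-(a * x ^ 9 * (b * y ^ 9)) : ℤ) : AlgebraicClosure ℚ) := by
        rw [← map_intCast (algebraMap ℚ (AlgebraicClosure ℚ))]
        simp only [freyCurve]
        push_cast
        rfl
      rw [e₂, e₄]
      exact this
    · push_cast
      refine threeDivision_ne_zero_of_three_dvd_trace ?_ ?_
        (freyCurve ((a : ZMod p) * x ^ 9) (b * y ^ 9)) rfl rfl rfl ?_ ?_ ?_ s
      · rwa [ZMod.ringChar_zmod_n]
      · rw [ZMod.card]; omega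
      · exact neg_ne_zero.2 (mul_ne_zero (mul_ne_zero ha (pow_ne_zero _ hx))
          (mul_ne_zero hb (pow_ne_zero _ hy)))
      · change ((b : ZMod p) * y ^ 9 - a * x ^ 9) ^ 2 - 4 * -(a * x ^ 9 * (b * y ^ 9)) ≠ 0
        rw [hdisc _ _ _ hsolp]
        exact pow_ne_zero _ (mul_ne_zero hc (pow_ne_zero _ hz))
      · rw [ZMod.card]
        exact hfermat
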